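/- Let $\mathbb K=\mathbb R$ or $\mathbb C$, and put $\beta=1$ if $\mathbb K=\mathbb R$ and $\beta=2$ if $\mathbb K=\mathbb C$. For every $n\ge1$ let $m_n\ge n$ be an integer, with $n/m_n\to\lambda\in[0,1]$ as $n\to\infty$; if $\lambda=0$, suppose also that there is $\alpha<2$ such that $m_n\le n^\alpha$ for $n$ large enough. Let $M_n$ be a (nonrandom) $n\times m_n$ matrix over $\mathbb K$ whose $n$ singular values are all $<K$, with $K$ independent of $n$, and suppose that the singular law of $M_n$ (the uniform law on its $n$ singular values) converges weakly to a probability measure $\mu$. Let $E_n$ be an $m_n\times n$ elementary matrix (one entry is $1$, all the others are $0$), let $U_n,V_n$ be independent Haar-distributed orthogonal (if $\mathbb K=\mathbb R$) or unitary (if $\mathbb K=\mathbb C$) matrices of sizes $n\times n$ and $m_n\times m_n$, and for $\theta\in\mathbb R$ let $$I_n(\theta)=\frac1n\log\mathbb E\left[\exp\left(\sqrt{nm_n}\,\theta\,\Re\operatorname{Tr}(E_nU_nM_nV_n)\right)\right].$$ For a compactly supported probability measure $\nu$ on $\mathbb R$ let $G_\nu(z)=\int\frac{d\nu(t)}{z-t}$,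 and let $R_\nu(z)=G_\nu^{-1}(z)-\frac1z$ be its $R$-transform, where $G_\nu^{-1}$ is the inverse of $G_\nu$ restricted to the real numbers outside the convex hull of the support of $\nu$, and $R_\nu(0)=\int t\,d\nu(t)$. Let $\mu_s(A)=\frac{\mu(A)+\mu(-A)}2$ be the symmetrization of $\mu$, and $\mu^2$ the push-forward of $\mu$ by $t\mapsto t^2$. Let $C^{(\lambda)}_\mu$ be the rectangular $R$-transform of $\mu$ with ratio $\lambda$: with $T^{(\lambda)}(z)=(\lambda z+1)(z+1)$ and $H(z)=z\,T^{(\lambda)}\left(\int\frac{t^2z}{1-t^2z}d\mu(t)\right)$, it is given by $C^{(\lambda)}_\mu(0)=0$ and, for $z\in(0,K^{-2})$, by $C^{(\lambda)}_\mu(z)=(T^{(\lambda)})^{-1}\left(z/H^{-1}(z)\right)$, where $T^{(\lambda)}$ is inverted on $[-1,\infty)$ and $H$ on the set of all $z\ge0$ such that $t^2z<1$ for every $t$ in the support of $\mu$. Put $$I(\theta)=\beta\int_0^{\theta/\beta}\frac{C^{(\lambda)}_\mu(t^2)}t\,dt .$$ If $\lambda=1$ or $\lambda=0$, then $I_n$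 converges to $I$ uniformly on every compact subset of $(-\beta/K,\beta/K)$, and for every $\theta$ in this interval $$I(\theta)=\beta\int_0^{\theta/\beta}R_{\mu_s}(t)\,dt\quad\text{if }\lambda=1,\qquad I(\theta)=\beta\int_0^{\theta/\beta}t\,R_{\mu^2}(t^2)\,dt\quad\text{if }\lambda=0,$$ where the integrands are integrable over the interval of integration. -/

import Mathlib

open MeasureTheory Filter Topology
open scoped NNReal ENNReal BoundedContinuousFunction

noncomputable section

/-! ### Haar measure on the orthogonal and unitary groups

For `𝕜 = ℝ` the group `Matrix.unitaryGroup (Fin n) 𝕜` is the orthogonal group, for `𝕜 = ℂ` it is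
the unitary group. -/

/-- The Borel sigma-algebra on the orthogonal or unitary group. -/
instance unitaryGroupMeasurableSpace (n : ℕ) (𝕜 : Type*) [RCLike 𝕜] :
    MeasurableSpace (Matrix.unitaryGroup (Fin n) 𝕜) := borel _

instance unitaryGroupBorelSpace (n : ℕ) (𝕜 : Type*) [RCLike 𝕜] :
    BorelSpace (Matrix.unitaryGroup (Fin n) 𝕜) := ⟨rfl⟩

instance unitaryGroupCompactSpace (n : ℕ) (𝕜 : Type*) [RCLike 𝕜] :
    CompactSpace (Matrix.unitaryGroup (Fin n) 𝕜) := by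
  apply isCompact_iff_compactSpace.mp
  have hc : IsCompact (Set.univ.pi fun _ : Fin n => Set.univ.pi fun _ : Fin n =>
      Metric.closedBall (0 : 𝕜) 1) :=
    isCompact_univ_pi fun _ => isCompact_univ_pi fun _ => isCompact_closedBall _ _
  refine IsCompact.of_isClosed_subset hc (isClosed_unitary (R := Matrix (Fin n) (Fin n) 𝕜)) ?_
  intro U hU i _ j _
  simpa using entry_norm_bound_of_unitary hU i j

/-- The Haar probability measure on the orthogonal or unitary group. -/
def haarUnitary (n : ℕ) (𝕜 : Type*) [RCLike 𝕜] :
    Measure (Matrix.unitaryGroup (Fin n) 𝕜) :=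
  Measure.haarMeasure ⊤

instance haarUnitary_isHaarMeasure (n : ℕ) (𝕜 : Type*) [RCLike 𝕜] :
    (haarUnitary n 𝕜).IsHaarMeasure :=
  inferInstanceAs (Measure.haarMeasure ⊤).IsHaarMeasure

instance haarUnitary_isProbabilityMeasure (n : ℕ) (𝕜 : Type*) [RCLike 𝕜] :
    IsProbabilityMeasure (haarUnitary n 𝕜) :=
  ⟨Measure.haarMeasure_self (K₀ := (⊤ : TopologicalSpace.PositiveCompacts
    (Matrix.unitaryGroup (Fin n) 𝕜)))⟩

/-! ### Matrices -/

/-- The index `β`: it is `1` for real matrices and `2` for complex matrices. -/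
def betaIndex (𝕜 : Type*) [RCLike 𝕜] : ℝ := (Module.finrank ℝ 𝕜 : ℝ)

/-- An elementary matrix: one entry is equal to one, all the others vanish. -/
def IsElementaryMatrix {p q : ℕ} {𝕜 : Type*} [RCLike 𝕜] (E : Matrix (Fin p) (Fin q) 𝕜) : Prop :=
  ∃ i j, E = Matrix.single i j 1

/-- The `n` singular values (with multiplicity, in decreasing order) of an `n × m` matrix with
`n ≤ m`. -/
def singVal {n m : ℕ} {𝕜 : Type*} [RCLike 𝕜] (M : Matrix (Fin n) (Fin m) 𝕜) (k : Fin n) : ℝ :=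
  (Matrix.toEuclideanLin M).singularValues k

/-- The singular law of an `n × m` matrix with `n ≤ m`: the uniform law on its `n` singular
values. -/
def singularLaw {n m : ℕ} {𝕜 : Type*} [RCLike 𝕜] (M : Matrix (Fin n) (Fin m) 𝕜) : Measure ℝ :=
  (n : ℝ≥0∞)⁻¹ • ∑ k : Fin n, Measure.dirac (singVal M k)

/-- `(1/n) log 𝔼 exp (√(n m) θ Re Tr (E U M V))`, where `U` and `V` are independent and
Haar-distributed on the orthogonal or unitary groups of sizes `n` and `m`. -/
def sphericalIntegral {n m : ℕ} {𝕜 : Type*} [RCLike 𝕜] (E : Matrix (Fin m) (Fin n) 𝕜)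
    (M : Matrix (Fin n) (Fin m) 𝕜) (θ : ℝ) : ℝ :=
  1 / (n : ℝ) * Real.log
    (∫ p : Matrix.unitaryGroup (Fin n) 𝕜 × Matrix.unitaryGroup (Fin m) 𝕜,
      Real.exp (Real.sqrt ((n : ℝ) * (m : ℝ)) * θ *
        RCLike.re (Matrix.trace
          (E * (p.1 : Matrix (Fin n) (Fin n) 𝕜) * M * (p.2 : Matrix (Fin m) (Fin m) 𝕜))))
      ∂((haarUnitary n 𝕜).prod (haarUnitary m 𝕜)))

/-- Weak convergence of a sequence of measures on the line, tested on bounded continuous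
functions. -/
def ConvergesWeakly (ν : ℕ → Measure ℝ) (μ : Measure ℝ) : Prop :=
  ∀ f : ℝ →ᵇ ℝ, Tendsto (fun n => ∫ x, f x ∂(ν n)) atTop (𝓝 (∫ x, f x ∂μ))

/-! ### Transforms of compactly supported probability measures on the line -/

/-- The symmetrization `A ↦ (μ A + μ (-A)) / 2` of `μ`. -/
def symmetrization (μ : Measure ℝ) : Measure ℝ :=
  (2 : ℝ≥0∞)⁻¹ • (μ + μ.map (fun t => -t))

/-- The push-forward of `μ` by `t ↦ t ^ 2`. -/
def squareLaw (μ : Measure ℝ) : Measure ℝ := μ.map (fun t => t ^ 2)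

/-- The Cauchy transform `G_ν(z) = ∫ dν(t) / (z - t)` at real points. -/
def cauchyTransform (ν : Measure ℝ) (z : ℝ) : ℝ := ∫ t, 1 / (z - t) ∂ν

/-- The `R`-transform `R_ν(z) = G_ν⁻¹(z) - 1 / z` of a compactly supported probability measure, at
real points. Here `G_ν` is inverted on the set of the real numbers outside the smallest interval
that carries `ν`: it is injective there, and its inverse is the one with `G_ν⁻¹(z) ~ 1 / z` at
zero. The value at `z = 0` is the one of the analytic extension, that is, the mean of `ν`. -/
def rTransform (ν : Measure ℝ) (z : ℝ) : ℝ :=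
  open Classical in
  if z = 0 then ∫ t, t ∂ν
  else Function.invFunOn (cauchyTransform ν) (convexHull ℝ ν.support)ᶜ z - 1 / z

/-- The generating function `∫ t² z / (1 - t² z) dμ(t)` of the moments of the push-forward of `μ`
by `t ↦ t ^ 2`. -/
def momentGen (μ : Measure ℝ) (z : ℝ) : ℝ := ∫ t, t ^ 2 * z / (1 - t ^ 2 * z) ∂μ

/-- `T(z) = (lam z + 1) (z + 1)`. -/
def rectT (lam z : ℝ) : ℝ := (lam * z + 1) * (z + 1)

/-- `H(z) = z T(M(z))`, with `M` the generating function `momentGen μ`. -/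
def rectH (lam : ℝ) (μ : Measure ℝ) (z : ℝ) : ℝ := z * rectT lam (momentGen μ z)

/-- The maximal interval of the form `[0, a)` or `[0, ∞)` on which `momentGen μ` is given by a
non-singular integrand. It contains `[0, K⁻²)` as soon as the support of `μ` is contained in
`[-K, K]`. -/
def rectDomain (μ : Measure ℝ) : Set ℝ := {z | 0 ≤ z ∧ ∀ t ∈ μ.support, t ^ 2 * z < 1}

/-- The rectangular `R`-transform with ratio `lam` of a compactly supported probability measure:
`C(z) = T⁻¹(z / H⁻¹(z))` for `z ≠ 0` and `C(0) = 0`, with `T` inverted on `[-1, ∞)`, and `H` on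
`rectDomain μ`, where it is increasing. -/
def rectRTransform (lam : ℝ) (μ : Measure ℝ) (z : ℝ) : ℝ :=
  open Classical in
  if z = 0 then 0
  else Function.invFunOn (rectT lam) (Set.Ici (-1))
    (z / Function.invFunOn (rectH lam μ) (rectDomain μ) z)

/-- `I(θ) = β ∫_0^{θ/β} C(t²) / t dt`, with `C` the rectangular `R`-transform of `μ` with ratio
`lam`. -/
def rectLimit (β lam : ℝ) (μ : Measure ℝ) (θ : ℝ) : ℝ :=
  β * ∫ t in (0 : ℝ)..(θ / β), rectRTransform lam μ (t ^ 2) / t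

end

/-! ### Gaussian integrals with respect to an additive Haar measure -/

section Gaussian

/-! Since `E` is elementary, the trace is one entry of `U M V`, and its Laplace transform can be
computed through Gaussian vectors. Give `g` and `h` densities proportional to `exp (-‖g‖ ^ 2)` and
`exp (-‖h‖ ^ 2)`, and average `exp (2 x Re ⟨g, U M V h⟩)` in two ways. For fixed `U, V` this is a
Gaussian integral, equal to `∏ (1 - x² sₖ²) ^ (-β / 2)`. Averaging over `U, V` first leaves a
function of `‖g‖ ‖h‖` only, and the radial moments turn the moments of the entry into the
coefficients `entryCoeff` of a power series in `w = x²`. By `hasSum_entryCoeff` the two agree. The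
spherical integral is therefore the same series with its `k`-th term divided by two rising
factorials.

With `N = β n`, those factorials become products of `T(2 i / N)` with ratio `n / m`, and
`tendsto_log_of_laplace` applies Laplace's method. Choose `w` with `H(w) = (θ / β)²` and put `x =
M(w)`, where `M = momentGen μ`. The product series tilted at `w` concentrates at `k ≈ x N / 2`,
because the logarithmic potential has derivative `M(w) / (2 w)`. The remaining weight is also
largest there, because `T` increases. The limit is the potential at `w` plus half of `∫_0^x (log
T(x) - log T(y)) dy`.

`rectLimit_integral` recognizes this value as `∫ C(t²) / t dt` by the substitution `t = √H(v)`,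
using `C(H(v)) = M(v)`. This holds for every ratio in `[0, 1]`. For ratios `1` and `0`,
`rectRTransform_one_div_eq` and `rectRTransform_zero_div_eq` solve the implicit equation for `C` in
terms of a Cauchy transform. Compact convergence follows from monotonicity of the spherical
integrals in `|θ|` and continuity of the limit. -/

/-- The integral of `exp (-‖x‖ ^ 2)`. -/
noncomputable def gaussMass {E : Type*} [NormedAddCommGroup E] [MeasurableSpace E]
    (ν : Measure E) : ℝ≥0∞ :=
  ∫⁻ x, ENNReal.ofReal (Real.exp (-‖x‖ ^ 2)) ∂ν

/-- Complete the square, `2 x Re ⟨g, y⟩ - ‖g‖² = x² ‖y‖² - ‖g - x y‖²`, and translate. -/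
theorem lintegral_exp_inner_sub_sq {𝕜 : Type*} [RCLike 𝕜] {E : Type*} [NormedAddCommGroup E]
    [InnerProductSpace 𝕜 E] [MeasurableSpace E] [BorelSpace E] (ν : Measure E)
    [ν.IsAddRightInvariant] (x : ℝ) (y : E) :
    ∫⁻ g, ENNReal.ofReal (Real.exp (2 * x * RCLike.re (inner 𝕜 g y) - ‖g‖ ^ 2)) ∂ν =
      ENNReal.ofReal (Real.exp (x ^ 2 * ‖y‖ ^ 2)) * gaussMass ν := by
  rw [gaussMass, ← lintegral_sub_right_eq_self (fun g => ENNReal.ofReal (Real.exp (-‖g‖ ^ 2))) ((x : 𝕜) • y), ← lintegral_const_mul]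
  · refine lintegral_congr fun g => ?_
    rw [← ENNReal.ofReal_mul (Real.exp_nonneg _), ← Real.exp_add]
    congr 2
    rw [@norm_sub_sq 𝕜, norm_smul, inner_smul_right]
    simp [mul_pow]
    ring
  · fun_prop

theorem lintegral_comp_linearMap {E : Type*} [NormedAddCommGroup E] [NormedSpace ℝ E]
    [FiniteDimensional ℝ E] [MeasurableSpace E] [BorelSpace E] (ν : Measure E) [ν.IsAddHaarMeasure]
    {L : E →ₗ[ℝ] E} (hL : LinearMap.det L ≠ 0) {f : E → ℝ≥0∞}
    (hf : Measurable f) :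
    ∫⁻ x, f (L x) ∂ν = ENNReal.ofReal |(LinearMap.det L)⁻¹| * ∫⁻ x, f x ∂ν := by
  have hLm : Measurable L := L.continuous_of_finiteDimensional.measurable
  rw [← lintegral_map hf hLm, Measure.map_linearMap_addHaar_eq_smul_addHaar ν hL,
    lintegral_smul_measure, smul_eq_mul]

/-- Polar coordinates. The constant does not depend on `j`, so ratios to the case `j = 0` are rising
factorials of half the real dimension. -/
theorem lintegral_norm_pow_mul_gauss {E : Type*} [NormedAddCommGroup E] [NormedSpace ℝ E]
    [FiniteDimensional ℝ E] [MeasurableSpace E] [BorelSpace E] [Nontrivial E]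
    (ν : Measure E) [ν.IsAddHaarMeasure] :
    ∃ c : ℝ, 0 < c ∧ ∀ j : ℕ,
    ∫⁻ x, ENNReal.ofReal (‖x‖ ^ (2 * j) * Real.exp (-‖x‖ ^ 2)) ∂ν =
      ENNReal.ofReal (c * Real.Gamma ((Module.finrank ℝ E : ℝ) / 2 + j)) := by
  set d := Module.finrank ℝ E with hd
  have hd0 : 0 < d := Module.finrank_pos
  refine ⟨d * ν.real (Metric.ball 0 1) / 2, ?_, fun j => ?_⟩
  · have : 0 < ν.real (Metric.ball (0 : E) 1) :=
      ENNReal.toReal_pos (Metric.measure_ball_pos ν _ one_pos).ne' measure_ball_lt_top.ne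
    positivity
  have key : ∀ y ∈ Set.Ioi (0 : ℝ), y ^ (d - 1) • (y ^ (2 * j) * Real.exp (-y ^ 2)) =
      y ^ ((d - 1 + 2 * j : ℕ) : ℝ) * Real.exp (-y ^ (2 : ℝ)) := by
    intro y _
    rw [Real.rpow_natCast, pow_add, smul_eq_mul, Real.rpow_two]
    ring
  have hq : (-1 : ℝ) < ((d - 1 + 2 * j : ℕ) : ℝ) :=
    lt_of_lt_of_le (by norm_num) (Nat.cast_nonneg _)
  have hint : Integrable (fun x : E => ‖x‖ ^ (2 * j) * Real.exp (-‖x‖ ^ 2)) ν := by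
    rw [integrable_fun_norm_addHaar ν (f := fun y => y ^ (2 * j) * Real.exp (-y ^ 2)),
      integrableOn_congr_fun key measurableSet_Ioi]
    simpa using integrableOn_rpow_mul_exp_neg_rpow hq (p := 2) (by norm_num)
  rw [← ofReal_integral_eq_lintegral_ofReal hint (Eventually.of_forall fun x => by positivity),
    integral_fun_norm_addHaar ν (fun y => y ^ (2 * j) * Real.exp (-y ^ 2)),
    setIntegral_congr_fun measurableSet_Ioi key,
    integral_rpow_mul_exp_neg_rpow (by norm_num) hq]
  congr 1
  have : ((d - 1 + 2 * j : ℕ) : ℝ) + 1 = d + 2 * j := by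
    norm_cast; omega
  rw [this, ← hd]
  simp only [nsmul_eq_mul, smul_eq_mul]
  rw [show ((d : ℝ) + 2 * j) / 2 = d / 2 + j by ring]
  ring

/-- The rising factorial `a (a + 1) ⋯ (a + j - 1)`. -/
def risingFactorial (a : ℝ) (j : ℕ) : ℝ := ∏ i ∈ Finset.range j, (a + i)

theorem risingFactorial_pos {a : ℝ} (ha : 0 < a) (j : ℕ) : 0 < risingFactorial a j :=
  Finset.prod_pos fun i _ => by positivity

theorem Gamma_add_natCast {a : ℝ} (ha : 0 < a) (j : ℕ) :
    Real.Gamma (a + j) = risingFactorial a j * Real.Gamma a := by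
  induction j with
  | zero => simp [risingFactorial]
  | succ j ih =>
    rw [risingFactorial, Finset.prod_range_succ, ← risingFactorial, Nat.cast_succ, ← add_assoc,
      Real.Gamma_add_one (by positivity), ih]
    ring

theorem gaussMass_ne {E : Type*} [NormedAddCommGroup E] [NormedSpace ℝ E]
    [FiniteDimensional ℝ E] [MeasurableSpace E] [BorelSpace E] [Nontrivial E]
    (ν : Measure E) [ν.IsAddHaarMeasure] : gaussMass ν ≠ 0 ∧ gaussMass ν ≠ ∞ := by
  obtain ⟨c, hc, h⟩ := lintegral_norm_pow_mul_gauss ν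
  have h0 := h 0
  have hd0 : 0 < Module.finrank ℝ E := Module.finrank_pos
  have : 0 < Real.Gamma ((Module.finrank ℝ E : ℝ) / 2) := Real.Gamma_pos_of_pos (by positivity)
  simp only [mul_zero, pow_zero, one_mul, Nat.cast_zero, add_zero] at h0
  rw [gaussMass, h0]
  exact ⟨by simpa using by positivity, ENNReal.ofReal_ne_top⟩

theorem lintegral_norm_pow_mul_gauss_eq {E : Type*} [NormedAddCommGroup E] [NormedSpace ℝ E]
    [FiniteDimensional ℝ E] [MeasurableSpace E] [BorelSpace E] [Nontrivial E]
    (ν : Measure E) [ν.IsAddHaarMeasure] (j : ℕ) :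
    ∫⁻ x, ENNReal.ofReal (‖x‖ ^ (2 * j) * Real.exp (-‖x‖ ^ 2)) ∂ν =
      ENNReal.ofReal (risingFactorial ((Module.finrank ℝ E : ℝ) / 2) j) * gaussMass ν := by
  obtain ⟨c, hc, h⟩ := lintegral_norm_pow_mul_gauss ν
  have h0 := h 0
  have hd0 : 0 < Module.finrank ℝ E := Module.finrank_pos
  have hd1 : (0 : ℝ) < (Module.finrank ℝ E : ℝ) / 2 := by positivity
  simp only [mul_zero, pow_zero, one_mul, Nat.cast_zero, add_zero] at h0
  rw [gaussMass, h0, h, Gamma_add_natCast hd1, ← ENNReal.ofReal_mul (risingFactorial_pos hd1 j).le]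
  congr 1
  ring

end Gaussian

/-! ### Quadratic forms and singular values -/

section SingularValues

variable {𝕜 : Type*} [RCLike 𝕜]
  {E : Type*} [NormedAddCommGroup E] [InnerProductSpace 𝕜 E] [FiniteDimensional 𝕜 E]
  {F : Type*} [NormedAddCommGroup F] [InnerProductSpace 𝕜 F] [FiniteDimensional 𝕜 F]

/-- `L` is the square root of the positive definite operator `1 - w T* T`, diagonal in an eigenbasis
of `T* T`. -/
theorem exists_norm_sq_eq_sub_of_singularValues (T : E →ₗ[𝕜] F) {w : ℝ}
    (hw : ∀ k, w * T.singularValues k ^ 2 < 1) :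
    ∃ L : E →ₗ[𝕜] E, (∀ h, ‖L h‖ ^ 2 = ‖h‖ ^ 2 - w * ‖T h‖ ^ 2) ∧
      LinearMap.det L =
        ((∏ k : Fin (Module.finrank 𝕜 E), Real.sqrt (1 - w * T.singularValues k ^ 2) : ℝ) : 𝕜) := by
  set hT := T.isSymmetric_adjoint_comp_self
  set b := hT.eigenvectorBasis rfl
  set r : Fin (Module.finrank 𝕜 E) → 𝕜 := fun k =>
    ((Real.sqrt (1 - w * T.singularValues k ^ 2) : ℝ) : 𝕜)
  have hrep : ∀ h k, b.repr (Matrix.toLin b.toBasis b.toBasis (Matrix.diagonal r) h) k =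
      r k * b.repr h k := by
    intro h k
    have := Matrix.repr_toLin b.toBasis b.toBasis (Matrix.diagonal r) h
    have := congrFun this k
    rw [Matrix.mulVec_diagonal] at this
    simpa using this
  refine ⟨Matrix.toLin b.toBasis b.toBasis (Matrix.diagonal r), fun h => ?_, ?_⟩
  · have h1 : ∀ y : E, ‖y‖ ^ 2 = ∑ k, ‖b.repr y k‖ ^ 2 := fun y => by
      rw [← b.repr.norm_map, EuclideanSpace.norm_sq_eq]
    have h2 : ‖T h‖ ^ 2 = ∑ k : Fin (Module.finrank 𝕜 E), T.singularValues k ^ 2 * ‖b.repr h k‖ ^ 2 := by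
      rw [← @inner_self_eq_norm_sq 𝕜, ← LinearMap.adjoint_inner_right, ← b.repr.inner_map_map,
        PiLp.inner_apply, map_sum]
      refine Finset.sum_congr rfl fun k _ => ?_
      have := hT.eigenvectorBasis_apply_self_apply rfl h k
      rw [LinearMap.comp_apply] at this
      rw [this, T.sq_singularValues_fin rfl k, ← smul_eq_mul, inner_smul_right,
        RCLike.re_ofReal_mul, inner_self_eq_norm_sq]
    rw [h1, h1 h, h2, Finset.mul_sum, ← Finset.sum_sub_distrib]
    refine Finset.sum_congr rfl fun k _ => ?_
    rw [hrep, norm_mul, mul_pow]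
    simp only [r, RCLike.norm_ofReal, sq_abs]
    rw [Real.sq_sqrt (by linarith [hw k])]
    ring
  · rw [LinearMap.det_toLin, Matrix.det_diagonal]
    simp [r]

end SingularValues

/-! ### Invariance of the Haar measure and the Laplace transform of an entry -/

section HaarInvariance

variable {𝕜 : Type*} [RCLike 𝕜]

instance haarUnitary_isMulRightInvariant (n : ℕ) (𝕜 : Type*) [RCLike 𝕜] :
    (haarUnitary n 𝕜).IsMulRightInvariant where
  map_mul_right_eq_self g := by
    have : IsProbabilityMeasure ((haarUnitary n 𝕜).map (· * g)) :=
      Measure.isProbabilityMeasure_map (by fun_prop)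
    exact Measure.isHaarMeasure_eq_of_isProbabilityMeasure _ _

instance unitaryGroup_secondCountableTopology (n : ℕ) (𝕜 : Type*) [RCLike 𝕜] :
    SecondCountableTopology (Matrix.unitaryGroup (Fin n) 𝕜) := by
  have : SecondCountableTopology (Matrix (Fin n) (Fin n) 𝕜) :=
    inferInstanceAs (SecondCountableTopology (Fin n → Fin n → 𝕜))
  exact TopologicalSpace.Subtype.secondCountableTopology _

/-- Extend the normalized vector to an orthonormal basis, placing it at index `j`; for `x = 0` any
unitary matrix will do. -/
theorem exists_unitary_column {n : ℕ} (x : EuclideanSpace 𝕜 (Fin n)) (j : Fin n) :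
    ∃ P : Matrix.unitaryGroup (Fin n) 𝕜, ∀ k, x k = (‖x‖ : 𝕜) * (P : Matrix _ _ 𝕜) k j := by
  by_cases hx : x = 0
  · exact ⟨1, by simp [hx]⟩
  have hx' : (‖x‖ : 𝕜) ≠ 0 := by simpa using hx
  set v : EuclideanSpace 𝕜 (Fin n) := (‖x‖ : 𝕜)⁻¹ • x
  have hv : ‖v‖ = 1 := by
    simp [v, norm_smul, hx]
  have hon : Orthonormal 𝕜 (({j} : Set (Fin n)).domRestrict fun _ : Fin n => v) := by
    refine ⟨fun _ => hv, fun i k hik => absurd (Subsingleton.elim i k) hik⟩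
  obtain ⟨b, hb⟩ := hon.exists_orthonormalBasis_extension_of_card_eq (by simp)
  refine ⟨⟨(EuclideanSpace.basisFun (Fin n) 𝕜).toBasis.toMatrix b,
    OrthonormalBasis.toMatrix_orthonormalBasis_mem_unitary _ _⟩, fun k => ?_⟩
  have : b j = v := hb j rfl
  simp only [Module.Basis.toMatrix_apply, this]
  simp [v, hx']

/-- The real part of an entry of `U M V`. -/
noncomputable def reEntry {n m : ℕ} (M : Matrix (Fin n) (Fin m) 𝕜) (j : Fin n) (i : Fin m)
    (p : Matrix.unitaryGroup (Fin n) 𝕜 × Matrix.unitaryGroup (Fin m) 𝕜) : ℝ :=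
  RCLike.re (((p.1 : Matrix (Fin n) (Fin n) 𝕜) * M * (p.2 : Matrix (Fin m) (Fin m) 𝕜)) j i)

variable {n m : ℕ} (M : Matrix (Fin n) (Fin m) 𝕜) (j : Fin n) (i : Fin m)

theorem continuous_reEntry : Continuous (reEntry M j i) := by
  unfold reEntry
  have h1 : Continuous fun p : Matrix.unitaryGroup (Fin n) 𝕜 × Matrix.unitaryGroup (Fin m) 𝕜 =>
      (p.1 : Matrix (Fin n) (Fin n) 𝕜) * M * (p.2 : Matrix (Fin m) (Fin m) 𝕜) := by fun_prop
  exact RCLike.continuous_re.comp ((continuous_apply i).comp ((continuous_apply j).comp h1))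

theorem integrable_haarUnitary_prod {f : Matrix.unitaryGroup (Fin n) 𝕜 × Matrix.unitaryGroup (Fin m) 𝕜 → ℝ} (hf : Continuous f) : Integrable f ((haarUnitary n 𝕜).prod (haarUnitary m 𝕜)) := by
  have := hf.integrable_of_hasCompactSupport (HasCompactSupport.of_compactSpace f) (μ := (haarUnitary n 𝕜).prod (haarUnitary m 𝕜))
  exact this

/-- The Laplace transform of the real part of an entry of `U M V`. -/
noncomputable def entryLaplace (ρ : ℝ) : ℝ :=
  ∫ p, Real.exp (ρ * reEntry M j i p) ∂((haarUnitary n 𝕜).prod (haarUnitary m 𝕜))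

/-- The even moments of the real part of an entry of `U M V`. -/
noncomputable def entryMoment (k : ℕ) : ℝ :=
  ∫ p, reEntry M j i p ^ (2 * k) ∂((haarUnitary n 𝕜).prod (haarUnitary m 𝕜))

theorem entryMoment_nonneg (k : ℕ) : 0 ≤ entryMoment M j i k :=
  integral_nonneg fun p => by rw [pow_mul]; positivity

theorem integral_comp_mul_mul (A : Matrix.unitaryGroup (Fin n) 𝕜)
    (B : Matrix.unitaryGroup (Fin m) 𝕜)
    (f : Matrix.unitaryGroup (Fin n) 𝕜 × Matrix.unitaryGroup (Fin m) 𝕜 → ℝ) :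
    ∫ p, f (A * p.1, p.2 * B) ∂((haarUnitary n 𝕜).prod (haarUnitary m 𝕜)) =
      ∫ p, f p ∂((haarUnitary n 𝕜).prod (haarUnitary m 𝕜)) := by
  have h1 : MeasurePreserving (fun U : Matrix.unitaryGroup (Fin n) 𝕜 => A * U)
      (haarUnitary n 𝕜) (haarUnitary n 𝕜) := measurePreserving_mul_left _ A
  have h2 : MeasurePreserving (fun U : Matrix.unitaryGroup (Fin m) 𝕜 => U * B)
      (haarUnitary m 𝕜) (haarUnitary m 𝕜) := measurePreserving_mul_right _ B
  exact (h1.prod h2).integral_comp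
    ((MeasurableEquiv.mulLeft A).prodCongr (MeasurableEquiv.mulRight B)).measurableEmbedding f

/-- Invariance of Haar measure under `U ↦ -U`; it is what leaves only even moments. -/
theorem entryLaplace_neg (ρ : ℝ) : entryLaplace M j i (-ρ) = entryLaplace M j i ρ := by
  rw [entryLaplace, entryLaplace, ← integral_comp_mul_mul (-1) 1]
  refine integral_congr_ae (Eventually.of_forall fun p => ?_)
  have : ((-1 * p.1 : Matrix.unitaryGroup (Fin n) 𝕜) : Matrix (Fin n) (Fin n) 𝕜) =
      -(p.1 : Matrix (Fin n) (Fin n) 𝕜) := by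
    rw [neg_one_mul]; rfl
  simp only [reEntry, this, mul_one]
  simp

/-- Evenness replaces `exp` by `cosh`, whose series may be integrated term by term since the entry
is bounded on a compact group. -/
theorem hasSum_entryLaplace (ρ : ℝ) :
    HasSum (fun k : ℕ => ρ ^ (2 * k) / (2 * k).factorial * entryMoment M j i k)
      (entryLaplace M j i ρ) := by
  set P := (haarUnitary n 𝕜).prod (haarUnitary m 𝕜)
  have hc := continuous_reEntry M j i
  obtain ⟨C, hC⟩ := isCompact_univ.exists_bound_of_continuousOn hc.continuousOn
  have h1 : entryLaplace M j i ρ = ∫ p, Real.cosh (ρ * reEntry M j i p) ∂P := by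
    have : entryLaplace M j i ρ = (entryLaplace M j i ρ + entryLaplace M j i (-ρ)) / 2 := by
      rw [entryLaplace_neg]; ring
    rw [this, entryLaplace, entryLaplace, ← integral_add, ← integral_div]
    · simp only [Real.cosh_eq, neg_mul, P]
    · exact integrable_haarUnitary_prod (by fun_prop)
    · exact integrable_haarUnitary_prod (by fun_prop)
  have hint : ∀ k : ℕ, Integrable (fun p => (ρ * reEntry M j i p) ^ (2 * k) / (2 * k).factorial) P :=
    fun k => integrable_haarUnitary_prod (by fun_prop)
  have h2 : ∀ k : ℕ, ∫ p, (ρ * reEntry M j i p) ^ (2 * k) / (2 * k).factorial ∂P =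
      ρ ^ (2 * k) / (2 * k).factorial * entryMoment M j i k := by
    intro k
    rw [entryMoment, ← integral_const_mul]
    refine integral_congr_ae (Eventually.of_forall fun p => ?_)
    simp only [mul_pow]; ring
  have h3 := hasSum_integral_of_summable_integral_norm hint ?_
  · simp only [h2] at h3
    rwa [h1, integral_congr_ae (Eventually.of_forall fun p => (Real.hasSum_cosh _).tsum_eq.symm)]
  · refine Summable.of_nonneg_of_le (fun k => integral_nonneg fun p => norm_nonneg _) (fun k => ?_)
      (Real.hasSum_cosh (ρ * C)).summable
    calc ∫ p, ‖(ρ * reEntry M j i p) ^ (2 * k) / (2 * k).factorial‖ ∂P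
        ≤ ∫ p, (ρ * C) ^ (2 * k) / (2 * k).factorial ∂P := by
          refine integral_mono (hint k).norm (integrable_const _) fun p => ?_
          have h := hC p (Set.mem_univ _)
          simp only [norm_div, norm_pow, norm_mul, Real.norm_natCast, pow_mul]
          rw [mul_pow ‖ρ‖, mul_pow ρ, Real.norm_eq_abs ρ, sq_abs]
          gcongr
      _ = _ := by simp

open scoped InnerProductSpace in
-- Write `g = ‖g‖ A e_j` and `h = ‖h‖ B e_i` with `A, B` unitary; the changes `U ↦ A⁻¹ U` and `V ↦ V
-- B` preserve Haar measure.
theorem integral_exp_inner_eq_entryLaplace (ρ : ℝ) (g : EuclideanSpace 𝕜 (Fin n))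
    (h : EuclideanSpace 𝕜 (Fin m)) :
    ∫ p : Matrix.unitaryGroup (Fin n) 𝕜 × Matrix.unitaryGroup (Fin m) 𝕜,
      Real.exp (ρ * RCLike.re (inner 𝕜 g (Matrix.toEuclideanLin
        ((p.1 : Matrix (Fin n) (Fin n) 𝕜) * M * (p.2 : Matrix (Fin m) (Fin m) 𝕜)) h)))
      ∂((haarUnitary n 𝕜).prod (haarUnitary m 𝕜)) =
    entryLaplace M j i (ρ * (‖g‖ * ‖h‖)) := by
  obtain ⟨A, hA⟩ := exists_unitary_column g j
  obtain ⟨B, hB⟩ := exists_unitary_column h i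
  rw [entryLaplace, ← integral_comp_mul_mul A⁻¹ B fun p =>
    Real.exp (ρ * (‖g‖ * ‖h‖) * reEntry M j i p)]
  refine integral_congr_ae (Eventually.of_forall fun p => ?_)
  have key : ∀ X : Matrix (Fin n) (Fin m) 𝕜, inner 𝕜 g (Matrix.toEuclideanLin X h) =
      ((‖g‖ * ‖h‖ : ℝ) : 𝕜) * (star (A : Matrix (Fin n) (Fin n) 𝕜) * X * (B : Matrix (Fin m) (Fin m) 𝕜)) j i := by
    intro X
    simp only [PiLp.inner_apply, Matrix.toLpLin_apply, Matrix.mulVec, dotProduct,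
      Matrix.mul_apply, Matrix.star_apply, hA, hB, RCLike.inner_apply, Finset.sum_mul,
      Finset.mul_sum, map_mul, RCLike.conj_ofReal]
    rw [Finset.sum_comm]
    refine Finset.sum_congr rfl fun a _ => Finset.sum_congr rfl fun c _ => ?_
    simp only [starRingEnd_apply]
    ring
  simp only [key, reEntry, RCLike.re_ofReal_mul]
  congr 1
  have : star (A : Matrix (Fin n) (Fin n) 𝕜) * ((p.1 : Matrix (Fin n) (Fin n) 𝕜) * M *
      (p.2 : Matrix (Fin m) (Fin m) 𝕜)) * (B : Matrix (Fin m) (Fin m) 𝕜) =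
    ((A⁻¹ * p.1 : Matrix.unitaryGroup (Fin n) 𝕜) : Matrix (Fin n) (Fin n) 𝕜) * M *
      ((p.2 * B : Matrix.unitaryGroup (Fin m) 𝕜) : Matrix (Fin m) (Fin m) 𝕜) := by
    simp [Matrix.mul_assoc]
  rw [this]
  ring

end HaarInvariance

/-! ### The generating function of the coefficients of the spherical integral -/

section GeneratingFunction

variable {𝕜 : Type*} [RCLike 𝕜] {n m : ℕ}

theorem betaIndex_pos (𝕜 : Type*) [RCLike 𝕜] : 0 < betaIndex 𝕜 := by
  unfold betaIndex
  exact_mod_cast Module.finrank_pos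

theorem finrank_real_euclideanSpace (n : ℕ) (𝕜 : Type*) [RCLike 𝕜] :
    (Module.finrank ℝ (EuclideanSpace 𝕜 (Fin n)) : ℝ) = betaIndex 𝕜 * n := by
  rw [← Module.finrank_mul_finrank ℝ 𝕜, finrank_euclideanSpace_fin, betaIndex]
  push_cast
  ring

theorem hasSum_of_tsum_ofReal_eq {a : ℕ → ℝ} (ha : ∀ k, 0 ≤ a k) {S : ℝ} (hS : 0 ≤ S)
    (h : ∑' k, ENNReal.ofReal (a k) = ENNReal.ofReal S) : HasSum a S := by
  have := ENNReal.hasSum_toReal (f := fun k => ENNReal.ofReal (a k)) (h ▸ ENNReal.ofReal_ne_top)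
  rw [← ENNReal.tsum_toReal_eq fun _ => ENNReal.ofReal_ne_top, h, ENNReal.toReal_ofReal hS] at this
  simpa only [ENNReal.toReal_ofReal (ha _)] using this

theorem singularValues_eq_zero_of_le (M : Matrix (Fin n) (Fin m) 𝕜) {k : ℕ} (hk : n ≤ k) :
    (Matrix.toEuclideanLin M).singularValues k = 0 := by
  rw [LinearMap.singularValues_eq_zero_iff_le_finrank_range]
  exact (Submodule.finrank_le _).trans (by simpa using hk)

/-- The coefficients of the power series of `∏ₖ (1 - w sₖ²) ^ (-β / 2)`. -/
noncomputable def entryCoeff (M : Matrix (Fin n) (Fin m) 𝕜) (j : Fin n) (i : Fin m) (k : ℕ) : ℝ :=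
  4 ^ k / (2 * k).factorial * entryMoment M j i k *
    (risingFactorial (betaIndex 𝕜 * n / 2) k * risingFactorial (betaIndex 𝕜 * m / 2) k)

variable (M : Matrix (Fin n) (Fin m) 𝕜) (j : Fin n) (i : Fin m)

include j i in
theorem risingFactorial_betaIndex_pos (k : ℕ) : 0 < risingFactorial (betaIndex 𝕜 * n / 2) k ∧ 0 < risingFactorial (betaIndex 𝕜 * m / 2) k := by
  have h1 := betaIndex_pos 𝕜
  have h2 : (0 : ℝ) < n := by exact_mod_cast j.pos
  have h3 : (0 : ℝ) < m := by exact_mod_cast i.pos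
  exact ⟨risingFactorial_pos (by positivity) _, risingFactorial_pos (by positivity) _⟩

theorem entryCoeff_nonneg (k : ℕ) : 0 ≤ entryCoeff M j i k := by
  have h1 := risingFactorial_betaIndex_pos (𝕜 := 𝕜) j i k
  have h2 := entryMoment_nonneg M j i k
  have := h1.1
  have := h1.2
  unfold entryCoeff
  positivity

theorem hasSum_entryLaplace_entryCoeff (z : ℝ) :
    HasSum (fun k : ℕ => entryCoeff M j i k * ((z ^ 2 / 4) ^ k /
      (risingFactorial (betaIndex 𝕜 * n / 2) k * risingFactorial (betaIndex 𝕜 * m / 2) k)))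
      (entryLaplace M j i z) := by
  convert hasSum_entryLaplace M j i z using 2 with k
  have h1 := risingFactorial_betaIndex_pos (𝕜 := 𝕜) j i k
  have := h1.1.ne'
  have := h1.2.ne'
  rw [entryCoeff, pow_mul, div_pow]
  field_simp

/-- The Gaussian average of `exp (2 x Re ⟨g, U M V h⟩)`, computed by expanding in moments. -/
theorem lintegral_gauss_entryLaplace_eq_tsum (x : ℝ) (ν : Measure (EuclideanSpace 𝕜 (Fin n)))
    [ν.IsAddHaarMeasure] (ν' : Measure (EuclideanSpace 𝕜 (Fin m))) [ν'.IsAddHaarMeasure] :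
    ∫⁻ h, ∫⁻ g, ENNReal.ofReal (entryLaplace M j i (2 * x * (‖g‖ * ‖h‖)) *
      (Real.exp (-‖g‖ ^ 2) * Real.exp (-‖h‖ ^ 2))) ∂ν ∂ν' =
    (∑' k, ENNReal.ofReal (entryCoeff M j i k * (x ^ 2) ^ k)) * (gaussMass ν * gaussMass ν') := by
  have : Nonempty (Fin n) := ⟨j⟩
  have : Nonempty (Fin m) := ⟨i⟩
  have hR := risingFactorial_betaIndex_pos (𝕜 := 𝕜) j i
  have hA := entryMoment_nonneg M j i
  set c : ℕ → ℝ := fun k => (2 * x) ^ (2 * k) / (2 * k).factorial * entryMoment M j i k with hc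
  have hc0 : ∀ k, 0 ≤ c k := fun k => by
    have := hA k
    simp only [hc, pow_mul]; positivity
  have hexp : ∀ (g : EuclideanSpace 𝕜 (Fin n)) (h : EuclideanSpace 𝕜 (Fin m)),
      ENNReal.ofReal (entryLaplace M j i (2 * x * (‖g‖ * ‖h‖)) *
        (Real.exp (-‖g‖ ^ 2) * Real.exp (-‖h‖ ^ 2))) =
      ∑' k, ENNReal.ofReal (c k) * (ENNReal.ofReal (‖g‖ ^ (2 * k) * Real.exp (-‖g‖ ^ 2)) *
        ENNReal.ofReal (‖h‖ ^ (2 * k) * Real.exp (-‖h‖ ^ 2))) := by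
    intro g h
    have hs := (hasSum_entryLaplace M j i (2 * x * (‖g‖ * ‖h‖))).mul_right
      (Real.exp (-‖g‖ ^ 2) * Real.exp (-‖h‖ ^ 2))
    have hk : ∀ k, (2 * x * (‖g‖ * ‖h‖)) ^ (2 * k) / (2 * k).factorial * entryMoment M j i k *
      (Real.exp (-‖g‖ ^ 2) * Real.exp (-‖h‖ ^ 2)) = c k * ((‖g‖ ^ (2 * k) * Real.exp (-‖g‖ ^ 2)) *
        (‖h‖ ^ (2 * k) * Real.exp (-‖h‖ ^ 2))) := fun k => by
      simp only [hc, mul_pow]; ring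
    simp only [hk] at hs
    rw [← hs.tsum_eq, ENNReal.ofReal_tsum_of_nonneg (fun k => mul_nonneg (hc0 k) (by positivity))
      hs.summable]
    refine tsum_congr fun k => ?_
    rw [ENNReal.ofReal_mul (p := c k) (hc0 k),
      ENNReal.ofReal_mul (p := ‖g‖ ^ (2 * k) * Real.exp (-‖g‖ ^ 2)) (by positivity)]
  simp only [hexp]
  have hin : ∀ h : EuclideanSpace 𝕜 (Fin m),
      ∫⁻ g, ∑' k, ENNReal.ofReal (c k) * (ENNReal.ofReal (‖g‖ ^ (2 * k) * Real.exp (-‖g‖ ^ 2)) *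
        ENNReal.ofReal (‖h‖ ^ (2 * k) * Real.exp (-‖h‖ ^ 2))) ∂ν =
      ∑' k, (ENNReal.ofReal (c k) * (ENNReal.ofReal (risingFactorial (betaIndex 𝕜 * n / 2) k) *
        gaussMass ν)) * ENNReal.ofReal (‖h‖ ^ (2 * k) * Real.exp (-‖h‖ ^ 2)) := by
    intro h
    rw [lintegral_tsum (fun k => by fun_prop)]
    refine tsum_congr fun k => ?_
    rw [lintegral_const_mul _ (by fun_prop), lintegral_mul_const _ (by fun_prop),
      lintegral_norm_pow_mul_gauss_eq, finrank_real_euclideanSpace]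
    ring
  simp only [hin]
  rw [lintegral_tsum (fun k => by fun_prop), ← ENNReal.tsum_mul_right]
  refine tsum_congr fun k => ?_
  rw [lintegral_const_mul _ (by fun_prop), lintegral_norm_pow_mul_gauss_eq,
    finrank_real_euclideanSpace]
  have : entryCoeff M j i k * (x ^ 2) ^ k = c k * (risingFactorial (betaIndex 𝕜 * n / 2) k *
      risingFactorial (betaIndex 𝕜 * m / 2) k) := by
    simp only [hc, entryCoeff, pow_mul, mul_pow]; ring
  rw [this, ENNReal.ofReal_mul (hc0 k), ENNReal.ofReal_mul (hR k).1.le]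
  ring

theorem norm_toEuclideanLin_unitary (U : Matrix.unitaryGroup (Fin n) 𝕜)
    (v : EuclideanSpace 𝕜 (Fin n)) :
    ‖Matrix.toEuclideanLin (U : Matrix (Fin n) (Fin n) 𝕜) v‖ = ‖v‖ := by
  rw [← sq_eq_sq₀ (norm_nonneg _) (norm_nonneg _), ← @inner_self_eq_norm_sq 𝕜,
    ← @inner_self_eq_norm_sq 𝕜, ← LinearMap.adjoint_inner_right,
    ← Matrix.toEuclideanLin_conjTranspose_eq_adjoint, ← Matrix.star_eq_conjTranspose,
    Matrix.toLpLin_apply, Matrix.toLpLin_apply, Matrix.mulVec_mulVec,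
    Unitary.coe_star_mul_self, Matrix.one_mulVec]

/-- The determinant has modulus one because the change of variables fixes the Gaussian mass, which
is neither zero nor infinite. -/
theorem lintegral_comp_isometry {E : Type*} [NormedAddCommGroup E] [NormedSpace ℝ E]
    [FiniteDimensional ℝ E] [MeasurableSpace E] [BorelSpace E] [Nontrivial E] (ν : Measure E)
    [ν.IsAddHaarMeasure] {L : E →ₗ[ℝ] E} (hL : ∀ x, ‖L x‖ = ‖x‖) {f : E → ℝ≥0∞}
    (hf : Measurable f) : ∫⁻ x, f (L x) ∂ν = ∫⁻ x, f x ∂ν := by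
  have hdet : LinearMap.det L ≠ 0 := fun h0 => by
    refine (LinearMap.bot_lt_ker_of_det_eq_zero h0).ne' (LinearMap.ker_eq_bot'.2 fun x hx => ?_)
    rw [← norm_eq_zero, ← hL, hx, norm_zero]
  have h1 := lintegral_comp_linearMap ν hdet
    (f := fun x => ENNReal.ofReal (Real.exp (-‖x‖ ^ 2))) (by fun_prop)
  simp only [hL] at h1
  obtain ⟨h2, h3⟩ := gaussMass_ne ν
  have h4 : ENNReal.ofReal |(LinearMap.det L)⁻¹| = 1 := by
    refine (ENNReal.mul_left_inj h2 h3).1 ?_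
    rw [one_mul]
    exact h1.symm
  rw [lintegral_comp_linearMap ν hdet hf, h4, one_mul]

/-- Passing from a `𝕜`-linear to a real determinant raises it to the power `β`, and each factor was
a square root, hence `β / 2`. Singular values of index at least `n` vanish and contribute factors
`1`. -/
theorem exists_norm_sq_eq_sub_of_singVal {w : ℝ} (hx : ∀ k : Fin n, w * singVal M k ^ 2 < 1)
    (hnm : n ≤ m) : ∃ L : EuclideanSpace 𝕜 (Fin m) →ₗ[ℝ] EuclideanSpace 𝕜 (Fin m),
      (∀ h, ‖L h‖ ^ 2 = ‖h‖ ^ 2 - w * ‖Matrix.toEuclideanLin M h‖ ^ 2) ∧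
      LinearMap.det L = ∏ k : Fin n, (1 - w * singVal M k ^ 2) ^ (betaIndex 𝕜 / 2) := by
  have hdet : ∃ L : EuclideanSpace 𝕜 (Fin m) →ₗ[𝕜] EuclideanSpace 𝕜 (Fin m),
      (∀ h, ‖L h‖ ^ 2 = ‖h‖ ^ 2 - w * ‖Matrix.toEuclideanLin M h‖ ^ 2) ∧
      LinearMap.det L = ((∏ k : Fin n, Real.sqrt (1 - w * singVal M k ^ 2) : ℝ) : 𝕜) := by
    obtain ⟨L, h1, h2⟩ := exists_norm_sq_eq_sub_of_singularValues (Matrix.toEuclideanLin M)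
      (w := w) fun k => by
        rcases lt_or_ge k n with hk | hk
        · exact hx ⟨k, hk⟩
        · simp [singularValues_eq_zero_of_le M hk]
    refine ⟨L, h1, h2.trans ?_⟩
    congr 1
    rw [Fin.prod_univ_eq_prod_range fun k =>
        Real.sqrt (1 - w * (Matrix.toEuclideanLin M).singularValues k ^ 2),
      finrank_euclideanSpace_fin]
    simp only [singVal]
    rw [Fin.prod_univ_eq_prod_range fun k =>
        Real.sqrt (1 - w * (Matrix.toEuclideanLin M).singularValues k ^ 2)]
    refine (Finset.prod_subset (Finset.range_mono hnm) fun k _ hk => ?_).symm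
    rw [singularValues_eq_zero_of_le M (by simpa using hk)]
    simp
  obtain ⟨L, hL1, hL2⟩ := hdet
  have hpos : ∀ k : Fin n, 0 < 1 - w * singVal M k ^ 2 := fun k => by linarith [hx k]
  refine ⟨L.restrictScalars ℝ, hL1, ?_⟩
  rw [LinearMap.det_restrictScalars, hL2, ← RCLike.algebraMap_eq_ofReal,
      Algebra.norm_algebraMap, ← Finset.prod_pow]
  refine Finset.prod_congr rfl fun k _ => ?_
  rw [Real.sqrt_eq_rpow, ← Real.rpow_natCast, ← Real.rpow_mul (hpos k).le, betaIndex]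
  congr 1
  ring

/-- The Gaussian average of `exp (2 x Re ⟨g, A h⟩)`. -/
theorem lintegral_gauss_bilinear {x : ℝ}
    (hx : ∀ k : Fin n, x ^ 2 * singVal M k ^ 2 < 1) (hnm : n ≤ m) [Nonempty (Fin m)]
    (U : Matrix.unitaryGroup (Fin n) 𝕜) (V : Matrix.unitaryGroup (Fin m) 𝕜)
    (ν : Measure (EuclideanSpace 𝕜 (Fin n)))
    [ν.IsAddHaarMeasure] (ν' : Measure (EuclideanSpace 𝕜 (Fin m))) [ν'.IsAddHaarMeasure] :
    ∫⁻ h, ∫⁻ g, ENNReal.ofReal (Real.exp (2 * x * RCLike.re (inner 𝕜 g (Matrix.toEuclideanLin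
        ((U : Matrix (Fin n) (Fin n) 𝕜) * M * (V : Matrix (Fin m) (Fin m) 𝕜)) h))) *
      (Real.exp (-‖g‖ ^ 2) * Real.exp (-‖h‖ ^ 2))) ∂ν ∂ν' =
    ENNReal.ofReal (∏ k : Fin n, (1 - x ^ 2 * singVal M k ^ 2) ^ (-(betaIndex 𝕜 / 2))) *
      (gaussMass ν * gaussMass ν') := by
  obtain ⟨L, hL1, hdetR⟩ := exists_norm_sq_eq_sub_of_singVal M hx hnm
  have hpos : ∀ k : Fin n, 0 < 1 - x ^ 2 * singVal M k ^ 2 := fun k => by linarith [hx k]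
  have hdetR0 : 0 < LinearMap.det L := by
    rw [hdetR]
    exact Finset.prod_pos fun k _ => Real.rpow_pos_of_pos (hpos k) _
  set VL : EuclideanSpace 𝕜 (Fin m) →ₗ[ℝ] EuclideanSpace 𝕜 (Fin m) :=
    (Matrix.toEuclideanLin (V : Matrix (Fin m) (Fin m) 𝕜)).restrictScalars ℝ
  -- Integrating out `g` completes the square; since `U` and `V` preserve norms, what remains in `h`
  -- is the Gaussian composed with `L` and `V`.
  have hinner : ∀ h : EuclideanSpace 𝕜 (Fin m),
      ∫⁻ g, ENNReal.ofReal (Real.exp (2 * x * RCLike.re (inner 𝕜 g (Matrix.toEuclideanLin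
        ((U : Matrix (Fin n) (Fin n) 𝕜) * M * (V : Matrix (Fin m) (Fin m) 𝕜)) h))) *
      (Real.exp (-‖g‖ ^ 2) * Real.exp (-‖h‖ ^ 2))) ∂ν =
      ENNReal.ofReal (Real.exp (-‖L (VL h)‖ ^ 2)) * gaussMass ν := by
    intro h
    have h1 : ‖Matrix.toEuclideanLin ((U : Matrix (Fin n) (Fin n) 𝕜) * M *
        (V : Matrix (Fin m) (Fin m) 𝕜)) h‖ = ‖Matrix.toEuclideanLin M (VL h)‖ := by
      rw [← norm_toEuclideanLin_unitary U (Matrix.toEuclideanLin M (VL h))]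
      simp [VL, Matrix.toLpLin_apply, Matrix.mul_assoc]
    have h2 : -‖L (VL h)‖ ^ 2 =
        x ^ 2 * ‖Matrix.toEuclideanLin M (VL h)‖ ^ 2 + -‖h‖ ^ 2 := by
      rw [hL1]
      rw [show ‖VL h‖ = ‖h‖ from norm_toEuclideanLin_unitary V h]
      ring
    rw [h2, Real.exp_add, ENNReal.ofReal_mul (Real.exp_nonneg _), ← h1, mul_right_comm,
      ← lintegral_exp_inner_sub_sq (𝕜 := 𝕜) ν x, ← lintegral_mul_const _ (by fun_prop)]
    refine lintegral_congr fun g => ?_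
    rw [← ENNReal.ofReal_mul (Real.exp_nonneg _), sub_eq_add_neg, Real.exp_add]
    congr 1
    ring
  have : Continuous L := LinearMap.continuous_of_finiteDimensional _
  have hVm : Continuous VL := LinearMap.continuous_of_finiteDimensional _
  have hVn : ∀ h, ‖VL h‖ = ‖h‖ := norm_toEuclideanLin_unitary V
  have hf : Measurable fun y => ENNReal.ofReal (Real.exp (-‖L y‖ ^ 2)) := by fun_prop
  have h3 := lintegral_comp_linearMap ν' hdetR0.ne'
    (f := fun y => ENNReal.ofReal (Real.exp (-‖y‖ ^ 2))) (by fun_prop)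
  rw [← gaussMass, abs_of_pos (inv_pos.2 hdetR0), hdetR, ← Finset.prod_inv_distrib] at h3
  have h4 := lintegral_comp_isometry ν' hVn hf
  have hf' : Measurable fun y => ENNReal.ofReal (Real.exp (-‖L (VL y)‖ ^ 2)) :=
    hf.comp hVm.measurable
  rw [lintegral_congr hinner, lintegral_mul_const _ hf', h4, h3, mul_assoc, mul_comm (gaussMass ν')]
  congr 3
  exact funext fun k => (Real.rpow_neg (hpos k).le _).symm

/-- Equate the two evaluations of the Gaussian average. All integrands are nonnegative, so the
exchanges of integrals need only measurability, and summability comes out of finiteness. -/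
theorem hasSum_entryCoeff {w : ℝ} (hw0 : 0 ≤ w) (hw : ∀ k : Fin n, w * singVal M k ^ 2 < 1)
    (hnm : n ≤ m) :
    HasSum (fun k : ℕ => entryCoeff M j i k * w ^ k)
      (∏ k : Fin n, (1 - w * singVal M k ^ 2) ^ (-(betaIndex 𝕜 / 2))) := by
  have : Nonempty (Fin n) := ⟨j⟩
  have : Nonempty (Fin m) := ⟨i⟩
  obtain ⟨x, rfl⟩ : ∃ x : ℝ, x ^ 2 = w := ⟨Real.sqrt w, Real.sq_sqrt hw0⟩
  refine hasSum_of_tsum_ofReal_eq (fun k => by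
    have := entryCoeff_nonneg M j i k
    positivity) (Finset.prod_nonneg fun k _ => Real.rpow_nonneg (by linarith [hw k]) _) ?_
  set ν : Measure (EuclideanSpace 𝕜 (Fin n)) := Measure.addHaar
  set ν' : Measure (EuclideanSpace 𝕜 (Fin m)) := Measure.addHaar
  set P := (haarUnitary n 𝕜).prod (haarUnitary m 𝕜)
  have h1 := lintegral_gauss_entryLaplace_eq_tsum M j i x ν ν'
  have hA : Continuous fun q : (EuclideanSpace 𝕜 (Fin m) × EuclideanSpace 𝕜 (Fin n)) ×
      (Matrix.unitaryGroup (Fin n) 𝕜 × Matrix.unitaryGroup (Fin m) 𝕜) =>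
      RCLike.re (inner 𝕜 q.1.2 (Matrix.toEuclideanLin
        ((q.2.1 : Matrix (Fin n) (Fin n) 𝕜) * M * (q.2.2 : Matrix (Fin m) (Fin m) 𝕜)) q.1.1)) := by
    refine RCLike.continuous_re.comp (Continuous.inner (by fun_prop) ?_)
    simp only [Matrix.toLpLin_apply]
    fun_prop
  have hcont : Continuous fun q : (EuclideanSpace 𝕜 (Fin m) × EuclideanSpace 𝕜 (Fin n)) ×
      (Matrix.unitaryGroup (Fin n) 𝕜 × Matrix.unitaryGroup (Fin m) 𝕜) =>
      ENNReal.ofReal (Real.exp (2 * x * RCLike.re (inner 𝕜 q.1.2 (Matrix.toEuclideanLin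
        ((q.2.1 : Matrix (Fin n) (Fin n) 𝕜) * M * (q.2.2 : Matrix (Fin m) (Fin m) 𝕜)) q.1.1))) *
      (Real.exp (-‖q.1.2‖ ^ 2) * Real.exp (-‖q.1.1‖ ^ 2))) :=
    ENNReal.continuous_ofReal.comp (by fun_prop)
  have h2 : ∀ (h : EuclideanSpace 𝕜 (Fin m)) (g : EuclideanSpace 𝕜 (Fin n)),
      ENNReal.ofReal (entryLaplace M j i (2 * x * (‖g‖ * ‖h‖)) *
      (Real.exp (-‖g‖ ^ 2) * Real.exp (-‖h‖ ^ 2))) =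
      ∫⁻ p, ENNReal.ofReal (Real.exp (2 * x * RCLike.re (inner 𝕜 g (Matrix.toEuclideanLin
        ((p.1 : Matrix (Fin n) (Fin n) 𝕜) * M * (p.2 : Matrix (Fin m) (Fin m) 𝕜)) h))) *
      (Real.exp (-‖g‖ ^ 2) * Real.exp (-‖h‖ ^ 2))) ∂P := by
    intro h g
    rw [← ofReal_integral_eq_lintegral_ofReal _ (Eventually.of_forall fun p => by positivity),
      integral_mul_const, integral_exp_inner_eq_entryLaplace]
    have := hA.comp (f := fun p => ((h, g), p)) (by fun_prop)
    refine integrable_haarUnitary_prod ?_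
    simp only [Function.comp_def] at this
    fun_prop
  simp only [h2] at h1
  have hm := hcont.measurable
  have h3 : ∀ h : EuclideanSpace 𝕜 (Fin m), ∫⁻ g, ∫⁻ p, ENNReal.ofReal (Real.exp (2 * x * RCLike.re (inner 𝕜 g (Matrix.toEuclideanLin
        ((p.1 : Matrix (Fin n) (Fin n) 𝕜) * M * (p.2 : Matrix (Fin m) (Fin m) 𝕜)) h))) *
      (Real.exp (-‖g‖ ^ 2) * Real.exp (-‖h‖ ^ 2))) ∂P ∂ν =
      ∫⁻ p, ∫⁻ g, ENNReal.ofReal (Real.exp (2 * x * RCLike.re (inner 𝕜 g (Matrix.toEuclideanLin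
        ((p.1 : Matrix (Fin n) (Fin n) 𝕜) * M * (p.2 : Matrix (Fin m) (Fin m) 𝕜)) h))) *
      (Real.exp (-‖g‖ ^ 2) * Real.exp (-‖h‖ ^ 2))) ∂ν ∂P := fun h =>
    lintegral_lintegral_swap (hm.comp (f := fun r : EuclideanSpace 𝕜 (Fin n) × _ => ((h, r.1), r.2)) (by fun_prop)).aemeasurable
  simp only [h3] at h1
  rw [lintegral_lintegral_swap] at h1
  · simp only [lintegral_gauss_bilinear M hw hnm, lintegral_const, measure_univ, mul_one] at h1
    have a1 := gaussMass_ne ν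
    have a2 := gaussMass_ne ν'
    exact ((ENNReal.mul_left_inj (mul_ne_zero a1.1 a2.1) (ENNReal.mul_ne_top a1.2 a2.2)).1 h1).symm
  · exact (Measurable.lintegral_prod_right' (f := fun r : (EuclideanSpace 𝕜 (Fin m) × (Matrix.unitaryGroup (Fin n) 𝕜 × Matrix.unitaryGroup (Fin m) 𝕜)) × EuclideanSpace 𝕜 (Fin n) => ENNReal.ofReal (Real.exp (2 * x * RCLike.re (inner 𝕜 r.2 (Matrix.toEuclideanLin
        ((r.1.2.1 : Matrix (Fin n) (Fin n) 𝕜) * M * (r.1.2.2 : Matrix (Fin m) (Fin m) 𝕜)) r.1.1))) *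
      (Real.exp (-‖r.2‖ ^ 2) * Real.exp (-‖r.1.1‖ ^ 2)))) (hm.comp (f := fun r : (EuclideanSpace 𝕜 (Fin m) × (Matrix.unitaryGroup (Fin n) 𝕜 × Matrix.unitaryGroup (Fin m) 𝕜)) × EuclideanSpace 𝕜 (Fin n) => ((r.1.1, r.2), r.1.2)) (by fun_prop))).aemeasurable

end GeneratingFunction

/-! ### Riemann sums of antitone functions -/

section RiemannSum

theorem integral_le_mul_sum_of_antitoneOn {f : ℝ → ℝ} (hf : AntitoneOn f (Set.Ici 0)) {h : ℝ}
    (hh : 0 < h) (k : ℕ) :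
    ∫ y in (0 : ℝ)..h * k, f y ≤ h * ∑ i ∈ Finset.range k, f (h * i) := by
  have h1 : AntitoneOn (fun y => f (h * y)) (Set.Icc 0 (0 + k)) := fun a ha b hb hab =>
    hf (mul_nonneg hh.le ha.1) (mul_nonneg hh.le hb.1) (by gcongr)
  have h2 := h1.integral_le_sum
  rw [intervalIntegral.integral_comp_mul_left f hh.ne'] at h2
  simp only [zero_add, mul_zero, smul_eq_mul] at h2
  rwa [inv_mul_le_iff₀ hh] at h2

theorem mul_sum_le_integral_of_antitoneOn {f : ℝ → ℝ} (hf : AntitoneOn f (Set.Ici 0))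
    (hf0 : ∀ y, 0 ≤ y → 0 ≤ f y) {h : ℝ} (hh : 0 < h) (k : ℕ) :
    h * ∑ i ∈ Finset.range k, f (h * i) ≤ h * f 0 + ∫ y in (0 : ℝ)..h * k, f y := by
  have h1 : AntitoneOn (fun y => f (h * y)) (Set.Icc 0 (0 + k)) := fun a ha b hb hab =>
    hf (mul_nonneg hh.le ha.1) (mul_nonneg hh.le hb.1) (by gcongr)
  have h2 := h1.sum_le_integral
  rw [intervalIntegral.integral_comp_mul_left f hh.ne'] at h2
  simp only [zero_add, mul_zero, smul_eq_mul] at h2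
  rw [le_inv_mul_iff₀ hh] at h2
  -- The right-endpoint sum is short of the left-endpoint one by the term at `0` and has an extra
  -- nonnegative term at `h k`.
  have h3 : ∑ i ∈ Finset.range k, f (h * i) ≤ f 0 + ∑ i ∈ Finset.range k, f (h * ↑(i + 1)) := by
    have h4 := Finset.sum_range_succ (fun i : ℕ => f (h * i)) k
    rw [Finset.sum_range_succ'] at h4
    have := hf0 (h * k) (by positivity)
    simp only [Nat.cast_zero, mul_zero] at h4
    linarith
  nlinarith [mul_le_mul_of_nonneg_left h3 hh.le]

end RiemannSum

/-! ### Laplace's method for the weighted series -/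

section Laplace

theorem one_le_rectT {l y : ℝ} (hl : 0 ≤ l) (hy : 0 ≤ y) : 1 + y ≤ rectT l y := by
  unfold rectT
  nlinarith [mul_nonneg hl hy, mul_nonneg (mul_nonneg hl hy) hy]

theorem rectT_pos {l y : ℝ} (hl : 0 ≤ l) (hy : 0 ≤ y) : 0 < rectT l y := by
  linarith [one_le_rectT hl hy]

theorem rectT_monotoneOn {l : ℝ} (hl : 0 ≤ l) : MonotoneOn (rectT l) (Set.Ici 0) := by
  intro a ha b hb hab
  simp only [Set.mem_Ici] at ha hb
  unfold rectT
  gcongr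

theorem log_rectT_monotoneOn {l : ℝ} (hl : 0 ≤ l) :
    MonotoneOn (fun y => Real.log (rectT l y)) (Set.Ici 0) := fun _ ha _ hb hab =>
  Real.log_le_log (rectT_pos hl ha) (rectT_monotoneOn hl ha hb hab)

/-- Only the factor `l y + 1` depends on the ratio, and `log u ≤ u - 1` controls the quotient of two
such factors. -/
theorem abs_log_rectT_sub_le {l l' y : ℝ} (hl : 0 ≤ l) (hl' : 0 ≤ l') (hy : 0 ≤ y) :
    |Real.log (rectT l y) - Real.log (rectT l' y)| ≤ |l - l'| * y := by
  have key : ∀ {l l' : ℝ}, 0 ≤ l → 0 ≤ l' →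
      Real.log (rectT l y) - Real.log (rectT l' y) ≤ |l - l'| * y := by
    intro l l' hl hl'
    have h1 : 0 < l * y + 1 := by positivity
    have h2 : 0 < l' * y + 1 := by positivity
    have h3 : 0 < y + 1 := by positivity
    rw [rectT, rectT, Real.log_mul h1.ne' h3.ne', Real.log_mul h2.ne' h3.ne', add_sub_add_right_eq_sub,
      ← Real.log_div h1.ne' h2.ne']
    refine (Real.log_le_sub_one_of_pos (by positivity)).trans ?_
    rw [div_sub_one h2.ne', div_le_iff₀ h2]
    have h4 : (l - l') * y ≤ |l - l'| * y := by gcongr; exact le_abs_self _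
    have h5 : 0 ≤ |l - l'| * y * (l' * y) := by positivity
    nlinarith
  rw [abs_le]
  have h1 := key hl hl'
  have h2 := key hl' hl
  rw [abs_sub_comm] at h2
  constructor <;> linarith

theorem continuousOn_log_rectT {l : ℝ} (hl : 0 ≤ l) :
    ContinuousOn (fun y => Real.log (rectT l y)) (Set.Ici 0) := by
  refine ContinuousOn.log ?_ fun y hy => (rectT_pos hl hy).ne'
  unfold rectT
  fun_prop

theorem intervalIntegrable_log_rectT {l a b : ℝ} (hl : 0 ≤ l) (ha : 0 ≤ a) (hb : 0 ≤ b) :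
    IntervalIntegrable (fun y => Real.log (rectT l y)) volume a b :=
  ((continuousOn_log_rectT hl).mono fun _ hy => (le_min ha hb).trans hy.1).intervalIntegrable

/-- Upper bound on the logarithm of the weights. -/
theorem mul_sum_log_rectT_le {l lam x₀ : ℝ} (hl : 0 ≤ l) (hlam : 0 ≤ lam) (hx₀ : 0 ≤ x₀) {h : ℝ}
    (hh : 0 < h) (k : ℕ) :
    h * ∑ i ∈ Finset.range k, (Real.log (rectT lam x₀) - Real.log (rectT l (h * i))) ≤
      h * Real.log (rectT lam x₀) + |l - lam| * rectT lam x₀ ^ 2 +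
        ∫ y in (0 : ℝ)..x₀, (Real.log (rectT lam x₀) - Real.log (rectT lam y)) := by
  set τ := Real.log (rectT lam x₀) with hτ
  set X := rectT lam x₀ with hX
  have hX1 : 1 + x₀ ≤ X := one_le_rectT hlam hx₀
  have hX0 : 0 ≤ X := by linarith
  have hτ0 : 0 ≤ τ := Real.log_nonneg (by linarith)
  -- The positive part only increases the sum, is antitone, and vanishes beyond `X = T(x₀)` because
  -- `T(y) ≥ 1 + y` for every ratio. The resulting bound is thus uniform in `k`.
  set f : ℝ → ℝ := fun y => max (τ - Real.log (rectT l y)) 0 with hf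
  have hfa : AntitoneOn f (Set.Ici 0) := fun a ha b hb hab =>
    max_le_max (sub_le_sub_left (log_rectT_monotoneOn hl ha hb hab) _) le_rfl
  have hf0 : ∀ y, 0 ≤ y → 0 ≤ f y := fun y _ => le_max_right _ _
  have hfX : ∀ y, X ≤ y → f y = 0 := fun y hy => by
    refine max_eq_right (sub_nonpos.2 (Real.log_le_log (by linarith) ?_))
    linarith [one_le_rectT hl (y := y) (by linarith)]
  have hfi : ∀ a b, 0 ≤ a → 0 ≤ b → IntervalIntegrable f volume a b := fun a b ha hb =>
    (hfa.mono fun y hy => (le_min ha hb).trans hy.1).intervalIntegrable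
  have h1 : ∑ i ∈ Finset.range k, (τ - Real.log (rectT l (h * i))) ≤
      ∑ i ∈ Finset.range k, f (h * i) := Finset.sum_le_sum fun i _ => le_max_left _ _
  have h2 := mul_sum_le_integral_of_antitoneOn hfa hf0 hh k
  have hf00 : f 0 = τ := by simp [hf, rectT, hτ0]
  have h3 : ∫ y in (0 : ℝ)..h * k, f y ≤ ∫ y in (0 : ℝ)..X, f y := by
    have hk : 0 ≤ h * k := by positivity
    rw [← intervalIntegral.integral_add_adjacent_intervals (hfi 0 X le_rfl (by linarith))
      (hfi X (h * k) (by linarith) hk)]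
    rcases le_total X (h * k) with hle | hle
    · have : ∫ y in X..h * k, f y = 0 := by
        rw [intervalIntegral.integral_congr (g := fun _ => 0)]
        · simp
        · intro y hy
          rw [Set.uIcc_of_le hle] at hy
          exact hfX y hy.1
      linarith
    · rw [intervalIntegral.integral_symm (h * k) X]
      have := intervalIntegral.integral_nonneg (μ := volume) hle fun y hy => hf0 y (hk.trans hy.1)
      linarith
  have hgi : ∀ a b, 0 ≤ a → 0 ≤ b →
      IntervalIntegrable (fun y => max (τ - Real.log (rectT lam y)) 0) volume a b := by
    intro a b ha hb
    refine AntitoneOn.intervalIntegrable fun c hc d hd hcd => max_le_max (sub_le_sub_left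
      (log_rectT_monotoneOn hlam ((le_min ha hb).trans hc.1) ((le_min ha hb).trans hd.1) hcd) _)
      le_rfl
  have h4 : ∫ y in (0 : ℝ)..X, f y ≤
      ∫ y in (0 : ℝ)..X, (max (τ - Real.log (rectT lam y)) 0 + |l - lam| * X) := by
    refine intervalIntegral.integral_mono_on (by linarith) (hfi _ _ le_rfl (by linarith))
      ((hgi _ _ le_rfl (by linarith)).add intervalIntegrable_const) fun y hy => ?_
    have h5 := abs_le.1 (abs_log_rectT_sub_le hl hlam hy.1)
    have h6 : |l - lam| * y ≤ |l - lam| * X := by gcongr; exact hy.2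
    have h7 := le_max_left (τ - Real.log (rectT lam y)) 0
    have h8 := le_max_right (τ - Real.log (rectT lam y)) 0
    refine max_le (by linarith) (by positivity)
  rw [intervalIntegral.integral_add (hgi _ _ le_rfl (by linarith)) intervalIntegrable_const,
    intervalIntegral.integral_const, ← intervalIntegral.integral_add_adjacent_intervals
      (hgi 0 x₀ le_rfl hx₀) (hgi x₀ X hx₀ (by linarith))] at h4
  have h5 : ∫ y in x₀..X, max (τ - Real.log (rectT lam y)) 0 = 0 := by
    rw [intervalIntegral.integral_congr (g := fun _ => 0)]
    · simp
    · intro y hy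
      rw [Set.uIcc_of_le (by linarith)] at hy
      exact max_eq_right (sub_nonpos.2 (log_rectT_monotoneOn hlam hx₀ (hx₀.trans hy.1) hy.1))
  have h6 : ∫ y in (0 : ℝ)..x₀, max (τ - Real.log (rectT lam y)) 0 =
      ∫ y in (0 : ℝ)..x₀, (τ - Real.log (rectT lam y)) := by
    refine intervalIntegral.integral_congr fun y hy => ?_
    rw [Set.uIcc_of_le hx₀] at hy
    exact max_eq_left (sub_nonneg.2 (log_rectT_monotoneOn hlam hy.1 hx₀ hy.2))
  rw [h5, h6] at h4
  simp only [sub_zero, smul_eq_mul] at h4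
  rw [hf00] at h2
  have := mul_le_mul_of_nonneg_left h1 hh.le
  nlinarith

/-- Lower bound on the logarithm of the weights. -/
theorem le_mul_sum_log_rectT {l lam x₀ δ : ℝ} (hl : 0 ≤ l) (hlam : 0 ≤ lam) (hx₀ : 0 ≤ x₀) {h : ℝ}
    (hh : 0 < h) (hδ : δ ≤ 1) {k : ℕ} (hk : |h * k - x₀| ≤ δ) :
    (∫ y in (0 : ℝ)..x₀, (Real.log (rectT lam x₀) - Real.log (rectT lam y))) -
      δ * Real.log (rectT lam (x₀ + 1)) - |l - lam| * (x₀ + 1) ^ 2 ≤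
    h * ∑ i ∈ Finset.range k, (Real.log (rectT lam x₀) - Real.log (rectT l (h * i))) := by
  set τ := Real.log (rectT lam x₀) with hτ
  have hτ0 : 0 ≤ τ := Real.log_nonneg (by linarith [one_le_rectT hlam hx₀])
  have hk' := abs_le.1 hk
  have hk0 : 0 ≤ h * k := by positivity
  have hfi : ∀ l a b, 0 ≤ l → 0 ≤ a → 0 ≤ b → IntervalIntegrable
      (fun y => τ - Real.log (rectT l y)) volume a b := fun l a b hl ha hb =>
    intervalIntegrable_const.sub (intervalIntegrable_log_rectT hl ha hb)
  have h1 := integral_le_mul_sum_of_antitoneOn (f := fun y => τ - Real.log (rectT l y))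
    (fun a ha b hb hab => sub_le_sub_left (log_rectT_monotoneOn hl ha hb hab) _) hh k
  have h2 : ∫ y in (0 : ℝ)..h * k, (τ - Real.log (rectT lam y) - |l - lam| * (x₀ + 1)) ≤
      ∫ y in (0 : ℝ)..h * k, (τ - Real.log (rectT l y)) := by
    refine intervalIntegral.integral_mono_on hk0 ((hfi lam _ _ hlam le_rfl hk0).sub
      intervalIntegrable_const) (hfi l _ _ hl le_rfl hk0) fun y hy => ?_
    have h5 := abs_le.1 (abs_log_rectT_sub_le hl hlam hy.1)
    have h6 : |l - lam| * y ≤ |l - lam| * (x₀ + 1) := by gcongr; linarith [hy.2]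
    linarith
  rw [intervalIntegral.integral_sub (hfi lam _ _ hlam le_rfl hk0) intervalIntegrable_const,
    intervalIntegral.integral_const, ← intervalIntegral.integral_add_adjacent_intervals
      (hfi lam 0 x₀ hlam le_rfl hx₀) (hfi lam x₀ (h * k) hlam hx₀ hk0)] at h2
  -- The endpoint `h k` is within `δ ≤ 1` of `x₀`, so on the gap both logarithms lie between `0` and
  -- `log T(x₀ + 1)`.
  have h3 : ‖∫ y in x₀..h * k, (τ - Real.log (rectT lam y))‖ ≤
      Real.log (rectT lam (x₀ + 1)) * |h * k - x₀| := by
    refine intervalIntegral.norm_integral_le_of_norm_le_const fun y hy => ?_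
    have hy' := Set.uIoc_subset_uIcc hy
    rw [Set.mem_uIcc] at hy'
    have hy0 : 0 ≤ y := by rcases hy' with h | h <;> linarith [h.1]
    have hy1 : y ≤ x₀ + 1 := by rcases hy' with h | h <;> linarith [h.2]
    have a1 := log_rectT_monotoneOn hlam hy0 (Set.mem_Ici.2 (by linarith : 0 ≤ x₀ + 1)) hy1
    have a2 := log_rectT_monotoneOn hlam hx₀ (Set.mem_Ici.2 (by linarith : 0 ≤ x₀ + 1))
      (by linarith : x₀ ≤ x₀ + 1)
    have a3 : 0 ≤ Real.log (rectT lam y) := Real.log_nonneg (by linarith [one_le_rectT hlam hy0])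
    simp only at a1 a2
    rw [Real.norm_eq_abs, abs_le]
    constructor <;> linarith
  have h4 : Real.log (rectT lam (x₀ + 1)) * |h * k - x₀| ≤ Real.log (rectT lam (x₀ + 1)) * δ :=
    mul_le_mul_of_nonneg_left hk (Real.log_nonneg (by
      linarith [one_le_rectT hlam (by linarith : 0 ≤ x₀ + 1)]))
  have h5 := (abs_le.1 h3).1
  have h6 : h * k * (|l - lam| * (x₀ + 1)) ≤ (x₀ + 1) * (|l - lam| * (x₀ + 1)) := by
    gcongr; linarith
  simp only [sub_zero, smul_eq_mul] at h2
  nlinarith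

/-- Exponential decay of the tails, at the level of the rate functions. -/
theorem exists_lt_of_hasDerivAt {Λ : ℝ → ℝ} {w₀ x₀ x κ : ℝ} (hw₀ : w₀ ∈ Set.Ioo 0 κ)
    (hd : HasDerivAt Λ (x₀ / (2 * w₀)) w₀) (hx : x ≠ x₀) :
    ∃ w ∈ Set.Ioo 0 κ, 0 < (w - w₀) * (x - x₀) ∧ Λ w - Λ w₀ - x / 2 * Real.log (w / w₀) < 0 := by
  have hw := hw₀.1
  have h1 : HasDerivAt (fun w => Λ w - Λ w₀ - x / 2 * Real.log (w / w₀))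
      (x₀ / (2 * w₀) - x / 2 * (1 / w₀ / (w₀ / w₀))) w₀ :=
    (hd.sub_const _).sub ((((hasDerivAt_id w₀).div_const w₀).log (by simp [hw.ne'])).const_mul _)
  have h2 : x₀ / (2 * w₀) - x / 2 * (1 / w₀ / (w₀ / w₀)) = (x₀ - x) / (2 * w₀) := by
    field_simp
  rw [h2] at h1
  have hv : Λ w₀ - Λ w₀ - x / 2 * Real.log (w₀ / w₀) = 0 := by simp [hw.ne']
  -- The function vanishes at `w₀` with slope of the sign of `x₀ - x`; a small move of `w` from `w₀`
  -- in the direction of `x - x₀` makes it negative.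
  have hmem : Set.Ioo 0 κ ∈ 𝓝 w₀ := isOpen_Ioo.mem_nhds hw₀
  have h3 := hasDerivAt_iff_tendsto_slope.1 h1
  rcases lt_or_gt_of_ne hx with hlt | hgt
  · have h4 := (h3.mono_left (nhdsLT_le_nhdsNE w₀)).eventually_const_lt
      (show 0 < (x₀ - x) / (2 * w₀) from div_pos (by linarith) (by linarith))
    obtain ⟨w, ⟨hw1, hw2⟩, hw3⟩ := ((h4.and (nhdsWithin_le_nhds hmem)).and
      self_mem_nhdsWithin).exists
    replace hw3 : w < w₀ := hw3
    refine ⟨w, hw2, by nlinarith, ?_⟩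
    rw [slope_def_field, hv, sub_zero] at hw1
    have := (div_pos_iff.1 hw1)
    rcases this with h | h
    · linarith [h.2]
    · exact h.1
  · have h4 := (h3.mono_left (nhdsGT_le_nhdsNE w₀)).eventually_lt_const
      (show (x₀ - x) / (2 * w₀) < 0 from div_neg_of_neg_of_pos (by linarith) (by linarith))
    obtain ⟨w, ⟨hw1, hw2⟩, hw3⟩ := ((h4.and (nhdsWithin_le_nhds hmem)).and
      self_mem_nhdsWithin).exists
    replace hw3 : w₀ < w := hw3
    refine ⟨w, hw2, by nlinarith, ?_⟩
    rw [slope_def_field, hv, sub_zero] at hw1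
    rcases div_neg_iff.1 hw1 with h | h
    · linarith [h.2]
    · exact h.1

theorem exp_mul_rpow_eq {N Λ r x : ℝ} (hr : 0 < r) :
    Real.exp (N * Λ) * r ^ (-(x * N / 2)) = Real.exp (N * (Λ - x / 2 * Real.log r)) := by
  rw [Real.rpow_def_of_pos hr, ← Real.exp_add]
  congr 1
  ring

/-- Laplace's method for power series with nonnegative coefficients and known growth. -/
theorem tendsto_log_of_laplace {N : ℕ → ℝ} (hN : Tendsto N atTop atTop) {l : ℕ → ℝ} {lam : ℝ}
    (hl0 : ∀ᶠ n in atTop, 0 ≤ l n) (hl : Tendsto l atTop (𝓝 lam)) {h : ℕ → ℕ → ℝ}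
    (h0 : ∀ᶠ n in atTop, ∀ k, 0 ≤ h n k) {κ : ℝ} {Λ : ℕ → ℝ → ℝ} {Λ' : ℝ → ℝ}
    (hZ : ∀ᶠ n in atTop, ∀ w ∈ Set.Ioo 0 κ,
      HasSum (fun k => h n k * w ^ k) (Real.exp (N n * Λ n w)))
    (hΛ : ∀ w ∈ Set.Ioo 0 κ, Tendsto (fun n => Λ n w) atTop (𝓝 (Λ' w)))
    {w₀ x₀ : ℝ} (hw₀ : w₀ ∈ Set.Ioo 0 κ) (hx₀ : 0 ≤ x₀)
    (hd : HasDerivAt Λ' (x₀ / (2 * w₀)) w₀) {F : ℕ → ℝ}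
    (hF : ∀ᶠ n in atTop, HasSum (fun k => h n k * ∏ i ∈ Finset.range k,
      (w₀ * rectT lam x₀ / rectT (l n) (2 / N n * i))) (F n)) :
    Tendsto (fun n => 1 / N n * Real.log (F n)) atTop (𝓝 (Λ' w₀ +
      (∫ y in (0 : ℝ)..x₀, (Real.log (rectT lam x₀) - Real.log (rectT lam y))) / 2)) := by
  have hlam : 0 ≤ lam := ge_of_tendsto hl hl0
  have hw := hw₀.1
  set G := ∫ y in (0 : ℝ)..x₀, (Real.log (rectT lam x₀) - Real.log (rectT lam y))
  set τ := Real.log (rectT lam x₀) with hτ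
  have hT := rectT_pos hlam hx₀
  set σ : ℕ → ℕ → ℝ := fun n k =>
    ∑ i ∈ Finset.range k, (τ - Real.log (rectT (l n) (2 / N n * i))) with hσ
  -- Each factor splits as `w₀` times `exp (log T(x₀) - log T(2 i / N))`: a tilted product series
  -- times a weight.
  have hterm : ∀ᶠ n in atTop, HasSum (fun k => h n k * w₀ ^ k * Real.exp (σ n k)) (F n) := by
    filter_upwards [hF, hl0, hN.eventually_gt_atTop 0] with n hFn hln hNn
    convert hFn using 2 with k
    rw [mul_assoc]
    congr 1
    rw [hσ, Real.exp_sum, ← Finset.card_range k, ← Finset.prod_const, Finset.card_range,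
      ← Finset.prod_mul_distrib]
    refine Finset.prod_congr rfl fun i _ => ?_
    rw [Real.exp_sub, hτ, Real.exp_log hT, Real.exp_log (rectT_pos hln (by positivity)),
      mul_div_assoc]
  have hupper : ∀ᶠ n in atTop, F n ≤ Real.exp (N n * (Λ n w₀ +
      (2 / N n * τ + |l n - lam| * rectT lam x₀ ^ 2 + G) / 2)) := by
    filter_upwards [hterm, hl0, hN.eventually_gt_atTop 0, h0, hZ] with n hFn hln hNn hh hZn
    have hs := (hZn w₀ hw₀).mul_right
      (Real.exp (N n * ((2 / N n * τ + |l n - lam| * rectT lam x₀ ^ 2 + G) / 2)))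
    rw [← Real.exp_add, ← mul_add] at hs
    refine hasSum_le (fun k => ?_) hFn hs
    have := hh k
    gcongr
    have h1 := mul_sum_log_rectT_le hln hlam hx₀ (h := 2 / N n) (by positivity) k
    rw [div_mul_eq_mul_div, div_le_iff₀ hNn] at h1
    simp only [hσ]
    linarith
  have hlower : ∀ δ, 0 < δ → δ ≤ 1 → ∀ᶠ n in atTop, Real.exp (N n * (Λ n w₀ +
      (G - δ * Real.log (rectT lam (x₀ + 1)) - |l n - lam| * (x₀ + 1) ^ 2) / 2)) / 2 ≤ F n := by
    intro δ hδ hδ1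
    -- Chernoff parameters for the two tails `2 k / N < x₀ - δ` and `2 k / N > x₀ + δ`. Each tail
    -- will carry at most a quarter of the mass at `w₀`, leaving at least half in the window.
    obtain ⟨u, hu, hu1, hu2⟩ := exists_lt_of_hasDerivAt hw₀ hd (x := x₀ - δ) (by linarith)
    obtain ⟨v, hv, hv1, hv2⟩ := exists_lt_of_hasDerivAt hw₀ hd (x := x₀ + δ) (by linarith)
    have hu3 : u < w₀ := by nlinarith
    have hv3 : w₀ < v := by nlinarith
    have hur : 0 < u / w₀ := div_pos hu.1 hw
    have hvr : 0 < v / w₀ := div_pos hv.1 hw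
    have htail : ∀ w ∈ Set.Ioo 0 κ, ∀ x, Λ' w - Λ' w₀ - x / 2 * Real.log (w / w₀) < 0 →
        ∀ᶠ n in atTop, Real.exp (N n * (Λ n w - x / 2 * Real.log (w / w₀))) ≤
          Real.exp (N n * Λ n w₀) * (1 / 4) := by
      intro w hw' x hx
      have h1 : Tendsto (fun n => Λ n w - Λ n w₀ - x / 2 * Real.log (w / w₀)) atTop
        (𝓝 (Λ' w - Λ' w₀ - x / 2 * Real.log (w / w₀))) := ((hΛ w hw').sub (hΛ w₀ hw₀)).sub_const _
      have h2 := Real.tendsto_exp_atBot.comp (hN.atTop_mul_neg hx h1)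
      filter_upwards [h2.eventually_le_const (show (0 : ℝ) < 1 / 4 by norm_num)] with n hn
      rw [Function.comp_apply] at hn
      calc _ = Real.exp (N n * Λ n w₀) *
            Real.exp (N n * (Λ n w - Λ n w₀ - x / 2 * Real.log (w / w₀))) := by
              rw [← Real.exp_add]; congr 1; ring
        _ ≤ _ := by gcongr
    filter_upwards [hterm, hl0, hN.eventually_gt_atTop 0, h0, hZ, htail u hu _ hu2,
      htail v hv _ hv2] with n hFn hln hNn hh hZn htu htv
    set q := Real.exp (N n * ((G - δ * Real.log (rectT lam (x₀ + 1)) -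
      |l n - lam| * (x₀ + 1) ^ 2) / 2)) with hq
    have hq0 : 0 < q := Real.exp_pos _
    -- The indicator of the window is bounded below by `1` minus two Chernoff factors; `q` bounds
    -- the weight below inside the window.
    have hs := (((hZn w₀ hw₀).sub ((hZn u hu).mul_right ((u / w₀) ^ (-((x₀ - δ) * N n / 2))))).sub
      ((hZn v hv).mul_right ((v / w₀) ^ (-((x₀ + δ) * N n / 2))))).mul_right q
    rw [exp_mul_rpow_eq hur, exp_mul_rpow_eq hvr] at hs
    have hle := hasSum_le (fun k => ?_) hs hFn
    · rw [mul_add, Real.exp_add, ← hq]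
      refine le_trans ?_ hle
      have : Real.exp (N n * Λ n w₀) / 2 ≤ Real.exp (N n * Λ n w₀) -
        Real.exp (N n * (Λ n u - (x₀ - δ) / 2 * Real.log (u / w₀))) -
        Real.exp (N n * (Λ n v - (x₀ + δ) / 2 * Real.log (v / w₀))) := by linarith
      nlinarith
    · have hkk := hh k
      have hpw : ∀ {w x : ℝ}, 0 < w / w₀ → h n k * w ^ k * (w / w₀) ^ (-(x * N n / 2)) =
          h n k * w₀ ^ k * (w / w₀) ^ ((k : ℝ) - x * N n / 2) := by
        intro w x hr
        rw [sub_eq_add_neg, Real.rpow_add hr, Real.rpow_natCast, div_pow]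
        field_simp
      rw [hpw hur, hpw hvr]
      have hA : 0 ≤ h n k * w₀ ^ k := by positivity
      have hB : 0 ≤ (u / w₀) ^ ((k : ℝ) - (x₀ - δ) * N n / 2) := Real.rpow_nonneg hur.le _
      have hC : 0 ≤ (v / w₀) ^ ((k : ℝ) - (x₀ + δ) * N n / 2) := Real.rpow_nonneg hvr.le _
      have hD : 0 ≤ Real.exp (σ n k) := (Real.exp_pos _).le
      rcases le_or_gt |2 / N n * k - x₀| δ with hk | hk
      · have h1 := le_mul_sum_log_rectT hln hlam hx₀ (h := 2 / N n) (by positivity) hδ1 hk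
        rw [div_mul_eq_mul_div, le_div_iff₀ hNn] at h1
        have h2 : q ≤ Real.exp (σ n k) := by
          rw [hq]
          refine Real.exp_le_exp.2 ?_
          simp only [hσ]
          linarith
        have h3 : h n k * w₀ ^ k * q ≤ h n k * w₀ ^ k * Real.exp (σ n k) := by gcongr
        have h4 := mul_nonneg (mul_nonneg hA hB) hq0.le
        have h5 := mul_nonneg (mul_nonneg hA hC) hq0.le
        nlinarith
      -- Outside the window one Chernoff factor is at least `1`, so the minorant is nonpositive.
      · have h6 : 1 ≤ (u / w₀) ^ ((k : ℝ) - (x₀ - δ) * N n / 2) ∨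
            1 ≤ (v / w₀) ^ ((k : ℝ) - (x₀ + δ) * N n / 2) := by
          rcases lt_abs.1 hk with h1 | h1
          · right
            refine Real.one_le_rpow ((one_le_div hw).2 hv3.le) ?_
            have : x₀ + δ < 2 * k / N n := by rw [div_mul_eq_mul_div] at h1; linarith
            rw [lt_div_iff₀ hNn] at this
            linarith
          · left
            refine Real.one_le_rpow_of_pos_of_le_one_of_nonpos hur ((div_le_one hw).2 hu3.le) ?_
            have : 2 * k / N n < x₀ - δ := by rw [div_mul_eq_mul_div] at h1; linarith
            rw [div_lt_iff₀ hNn] at this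
            linarith
        have h7 : h n k * w₀ ^ k - h n k * w₀ ^ k * (u / w₀) ^ ((k : ℝ) - (x₀ - δ) * N n / 2) -
            h n k * w₀ ^ k * (v / w₀) ^ ((k : ℝ) - (x₀ + δ) * N n / 2) ≤ 0 := by
          rcases h6 with h6 | h6
          · nlinarith [mul_nonneg hA hC]
          · nlinarith [mul_nonneg hA hB]
        exact (mul_nonpos_of_nonpos_of_nonneg h7 hq0.le).trans (mul_nonneg hA hD)
  have hNi : Tendsto (fun n => 1 / N n) atTop (𝓝 0) := by
    simp only [one_div]
    exact hN.inv_tendsto_atTop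
  have hld : Tendsto (fun n => |l n - lam|) atTop (𝓝 0) := by
    have := (hl.sub_const lam).abs
    simpa using this
  rw [tendsto_order]
  constructor
  · intro a ha
    obtain ⟨δ, hδ, hδ1, hδa⟩ : ∃ δ, 0 < δ ∧ δ ≤ 1 ∧
        a < Λ' w₀ + (G - δ * Real.log (rectT lam (x₀ + 1))) / 2 := by
      have h1 : Tendsto (fun δ : ℝ => Λ' w₀ + (G - δ * Real.log (rectT lam (x₀ + 1))) / 2)
          (𝓝[>] 0) (𝓝 (Λ' w₀ + (G - 0 * Real.log (rectT lam (x₀ + 1))) / 2)) := by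
        refine Tendsto.mono_left (Continuous.tendsto ?_ 0) nhdsWithin_le_nhds
        fun_prop
      rw [zero_mul, sub_zero] at h1
      obtain ⟨δ, h2, h3⟩ := ((h1.eventually_const_lt ha).and
        (Ioc_mem_nhdsGT (zero_lt_one' ℝ))).exists
      exact ⟨δ, h3.1, h3.2, h2⟩
    have h1 : Tendsto (fun n => Λ n w₀ + (G - δ * Real.log (rectT lam (x₀ + 1)) -
        |l n - lam| * (x₀ + 1) ^ 2) / 2 - 1 / N n * Real.log 2) atTop
        (𝓝 (Λ' w₀ + (G - δ * Real.log (rectT lam (x₀ + 1)) - 0 * (x₀ + 1) ^ 2) / 2 -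
          0 * Real.log 2)) :=
      ((hΛ w₀ hw₀).add (((tendsto_const_nhds).sub (hld.mul_const _)).div_const _)).sub
        (hNi.mul_const _)
    simp only [zero_mul, sub_zero] at h1
    filter_upwards [h1.eventually_const_lt hδa, hlower δ hδ hδ1, hN.eventually_gt_atTop 0] with
      n h2 h3 hNn
    refine h2.trans_le ?_
    have h4 := Real.log_le_log (by positivity) h3
    rw [Real.log_div (Real.exp_pos _).ne' two_ne_zero, Real.log_exp] at h4
    have h5 := mul_le_mul_of_nonneg_left h4 (one_div_pos.2 hNn).le
    rw [mul_sub, ← mul_assoc, one_div_mul_cancel hNn.ne', one_mul] at h5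
    exact h5
  · intro a ha
    have h1 : Tendsto (fun n => Λ n w₀ +
        (2 * (1 / N n) * τ + |l n - lam| * rectT lam x₀ ^ 2 + G) / 2) atTop
        (𝓝 (Λ' w₀ + (2 * 0 * τ + 0 * rectT lam x₀ ^ 2 + G) / 2)) :=
      (hΛ w₀ hw₀).add (((((hNi.const_mul 2).mul_const _).add (hld.mul_const _)).add_const _).div_const _)
    simp only [mul_zero, zero_mul, zero_add] at h1
    filter_upwards [h1.eventually_lt_const ha, hupper, hlower 1 one_pos le_rfl,
      hN.eventually_gt_atTop 0] with n h2 h3 h4 hNn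
    refine lt_of_le_of_lt ?_ h2
    have hF0 : 0 < F n := lt_of_lt_of_le (by positivity) h4
    have h4 := Real.log_le_log hF0 h3
    rw [Real.log_exp] at h4
    have h5 := mul_le_mul_of_nonneg_left h4 (one_div_pos.2 hNn).le
    rw [← mul_assoc, one_div_mul_cancel hNn.ne', one_mul] at h5
    rwa [mul_one_div]

end Laplace

/-! ### The rectangular `R`-transform and its primitive -/

section RectangularTransform

/-- The integral of `-log (1 - w t ^ 2) / 2`. -/
noncomputable def logPotential (μ : Measure ℝ) (w : ℝ) : ℝ :=
  -(1 / 2) * ∫ t, Real.log (1 - t ^ 2 * w) ∂μ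

variable {μ : Measure ℝ} [IsProbabilityMeasure μ] {R : ℝ}

omit [IsProbabilityMeasure μ] in
theorem momentGen_zero : momentGen μ 0 = 0 := by simp [momentGen]

omit [IsProbabilityMeasure μ] in
theorem logPotential_zero : logPotential μ 0 = 0 := by simp [logPotential]

/-- Keeps `1 - t² v` away from zero uniformly for `v` near `w`, which gives the domination needed to
differentiate under the integral. -/
theorem exists_lower_bound (hR : 0 < R) {w : ℝ} (hw : w < R⁻¹) :
    ∃ b, w < b ∧ 0 < 1 - R * b ∧ ∀ t, t ^ 2 ≤ R → ∀ v ∈ Set.Iio b, 1 - R * b ≤ 1 - t ^ 2 * v := by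
  obtain ⟨b, hb1, hb2⟩ := exists_between (max_lt hw (inv_pos.2 hR))
  have hb0 : 0 ≤ b := (le_max_right _ _).trans hb1.le
  refine ⟨b, (le_max_left _ _).trans_lt hb1, ?_, fun t ht v hv => ?_⟩
  · have := mul_lt_mul_of_pos_left hb2 hR
    rw [mul_inv_cancel₀ hR.ne'] at this
    linarith
  · have hv' : v ≤ b := le_of_lt hv
    have h1 : t ^ 2 * v ≤ t ^ 2 * b := by gcongr
    have h2 : t ^ 2 * b ≤ R * b := by gcongr
    linarith

theorem integrable_of_ae_sq_le (hμ : ∀ᵐ t ∂μ, t ^ 2 ≤ R) {f : ℝ → ℝ} (hf : Measurable f) {C : ℝ}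
    (hC : ∀ t, t ^ 2 ≤ R → |f t| ≤ C) : Integrable f μ :=
  Integrable.of_bound hf.aestronglyMeasurable C (hμ.mono fun t ht => hC t ht)

theorem hasDerivAt_logPotential (hR : 0 < R) (hμ : ∀ᵐ t ∂μ, t ^ 2 ≤ R) {w : ℝ} (hw : w < R⁻¹) :
    HasDerivAt (logPotential μ) ((∫ t, t ^ 2 / (1 - t ^ 2 * w) ∂μ) / 2) w := by
  obtain ⟨b, hb, hc, hbd⟩ := exists_lower_bound hR hw
  set c := 1 - R * b with hcdef
  have h := (hasDerivAt_integral_of_dominated_loc_of_deriv_le (μ := μ)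
    (F := fun v t => Real.log (1 - t ^ 2 * v)) (F' := fun v t => -t ^ 2 / (1 - t ^ 2 * v))
    (bound := fun _ => R / c) (s := Set.Iio b) (Iio_mem_nhds hb)
    (Eventually.of_forall fun v => Measurable.aestronglyMeasurable (by fun_prop)) ?_
    (Measurable.aestronglyMeasurable (by fun_prop)) ?_ (integrable_const _) ?_).2
  · have h2 := h.const_mul (-(1 / 2))
    refine h2.congr_deriv ?_
    simp only [neg_div, integral_neg]
    ring
  · refine integrable_of_ae_sq_le hμ (by fun_prop) (C := R * |w| + 1 / c) fun t ht => ?_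
    have h1 := hbd t ht w hb
    have h2 : 0 < 1 - t ^ 2 * w := hc.trans_le h1
    have h3 := Real.log_le_sub_one_of_pos h2
    have h4 := Real.one_sub_inv_le_log_of_pos h2
    have h5 : (1 - t ^ 2 * w)⁻¹ ≤ 1 / c := by rw [one_div]; exact inv_anti₀ hc h1
    have h6 : |t ^ 2 * w| ≤ R * |w| := by
      rw [abs_mul, abs_of_nonneg (sq_nonneg t)]; gcongr
    have h7 := abs_le.1 h6
    have h8 : 0 < 1 / c := by positivity
    rw [abs_le]
    constructor <;> linarith
  · filter_upwards [hμ] with t ht v hv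
    have h1 := hbd t ht v hv
    have h2 : 0 < 1 - t ^ 2 * v := hc.trans_le h1
    rw [norm_div, norm_neg, Real.norm_of_nonneg (sq_nonneg t), Real.norm_of_nonneg h2.le]
    gcongr
  · filter_upwards [hμ] with t ht v hv
    have h2 : 0 < 1 - t ^ 2 * v := hc.trans_le (hbd t ht v hv)
    have := (((hasDerivAt_id v).const_mul (t ^ 2)).const_sub 1).log h2.ne'
    simpa using this

theorem hasDerivAt_momentGen (hR : 0 < R) (hμ : ∀ᵐ t ∂μ, t ^ 2 ≤ R) {w : ℝ} (hw : w < R⁻¹) :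
    HasDerivAt (momentGen μ) (∫ t, t ^ 2 / (1 - t ^ 2 * w) ^ 2 ∂μ) w := by
  obtain ⟨b, hb, hc, hbd⟩ := exists_lower_bound hR hw
  set c := 1 - R * b with hcdef
  refine (hasDerivAt_integral_of_dominated_loc_of_deriv_le (μ := μ)
    (F := fun v t => t ^ 2 * v / (1 - t ^ 2 * v)) (F' := fun v t => t ^ 2 / (1 - t ^ 2 * v) ^ 2)
    (bound := fun _ => R / c ^ 2) (s := Set.Iio b) (Iio_mem_nhds hb)
    (Eventually.of_forall fun v => Measurable.aestronglyMeasurable (by fun_prop)) ?_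
    (Measurable.aestronglyMeasurable (by fun_prop)) ?_ (integrable_const _) ?_).2
  · refine integrable_of_ae_sq_le hμ (by fun_prop) (C := R * |w| / c) fun t ht => ?_
    have h1 := hbd t ht w hb
    have h2 : 0 < 1 - t ^ 2 * w := hc.trans_le h1
    rw [abs_div, abs_mul, abs_of_nonneg (sq_nonneg t), abs_of_nonneg h2.le]
    gcongr
  · filter_upwards [hμ] with t ht v hv
    have h1 := hbd t ht v hv
    have h2 : 0 < 1 - t ^ 2 * v := hc.trans_le h1
    rw [norm_div, norm_pow (1 - t ^ 2 * v), Real.norm_of_nonneg h2.le, Real.norm_of_nonneg (sq_nonneg t)]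
    gcongr
  · filter_upwards [hμ] with t ht v hv
    have h2 : 0 < 1 - t ^ 2 * v := hc.trans_le (hbd t ht v hv)
    have h3 := (hasDerivAt_id v).const_mul (t ^ 2)
    have := h3.div (h3.const_sub 1) h2.ne'
    refine this.congr_deriv ?_
    simp only [id, mul_one]
    ring

omit [IsProbabilityMeasure μ] in
theorem momentGen_eq_mul (w : ℝ) : momentGen μ w = w * ∫ t, t ^ 2 / (1 - t ^ 2 * w) ∂μ := by
  rw [momentGen, ← integral_const_mul]
  congr 1
  ext t
  ring

/-- The saddle-point relation: it identifies the concentration point of Laplace's method at `w` as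
`M(w)`. -/
theorem hasDerivAt_logPotential_momentGen (hR : 0 < R) (hμ : ∀ᵐ t ∂μ, t ^ 2 ≤ R) {w : ℝ} (hw0 : 0 < w)
    (hw : w < R⁻¹) : HasDerivAt (logPotential μ) (momentGen μ w / (2 * w)) w := by
  refine (hasDerivAt_logPotential hR hμ hw).congr_deriv ?_
  rw [momentGen_eq_mul, mul_comm 2 w, mul_div_mul_left _ _ hw0.ne']

theorem sq_mul_lt_one {t w : ℝ} (hR : 0 < R) (hw0 : 0 ≤ w) (hw : w < R⁻¹) (ht : t ^ 2 ≤ R) :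
    t ^ 2 * w < 1 := by
  have h1 : t ^ 2 * w ≤ R * w := by gcongr
  have h2 := mul_lt_mul_of_pos_left hw hR
  rw [mul_inv_cancel₀ hR.ne'] at h2
  linarith

omit [IsProbabilityMeasure μ] in
theorem support_subset_sq_le (hμ : ∀ᵐ t ∂μ, t ^ 2 ≤ R) : μ.support ⊆ {t | t ^ 2 ≤ R} :=
  Measure.support_subset_of_isClosed (isClosed_le (by fun_prop) (by fun_prop)) hμ

omit [IsProbabilityMeasure μ] in
theorem isCompact_support_of_sq_le (hμ : ∀ᵐ t ∂μ, t ^ 2 ≤ R) : IsCompact μ.support := by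
  refine (isCompact_Icc (a := -Real.sqrt R) (b := Real.sqrt R)).of_isClosed_subset
    Measure.isClosed_support fun t ht => ?_
  have := Real.sqrt_le_sqrt (support_subset_sq_le hμ ht)
  rw [Real.sqrt_sq_eq_abs] at this
  exact abs_le.1 this

omit [IsProbabilityMeasure μ] in
theorem mem_rectDomain (hR : 0 < R) (hμ : ∀ᵐ t ∂μ, t ^ 2 ≤ R) {w : ℝ} (hw0 : 0 ≤ w)
    (hw : w < R⁻¹) : w ∈ rectDomain μ :=
  ⟨hw0, fun _ ht => sq_mul_lt_one hR hw0 hw (support_subset_sq_le hμ ht)⟩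

/-- The support is compact and nonempty, so the strict pointwise bound is attained at a maximum and
becomes uniform. -/
theorem exists_bound_of_mem_rectDomain (hμ : ∀ᵐ t ∂μ, t ^ 2 ≤ R) {w : ℝ}
    (hw : w ∈ rectDomain μ) : ∃ c < 1, ∀ᵐ t ∂μ, t ^ 2 * w ≤ c := by
  have hne : μ.support.Nonempty := Measure.nonempty_support (IsProbabilityMeasure.ne_zero μ)
  obtain ⟨t, ht, hmax⟩ := (isCompact_support_of_sq_le hμ).exists_isMaxOn hne
    (f := fun t : ℝ => t ^ 2 * w) (by fun_prop)
  refine ⟨t ^ 2 * w, hw.2 t ht, ?_⟩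
  filter_upwards [Measure.support_mem_ae (μ := μ)] with s hs using hmax hs

theorem integrable_momentGen (hμ : ∀ᵐ t ∂μ, t ^ 2 ≤ R) {w : ℝ} (hw : w ∈ rectDomain μ) :
    Integrable (fun t => t ^ 2 * w / (1 - t ^ 2 * w)) μ := by
  obtain ⟨c, hc, h⟩ := exists_bound_of_mem_rectDomain hμ hw
  refine Integrable.of_bound (Measurable.aestronglyMeasurable (by fun_prop)) (1 / (1 - c)) (h.mono fun t ht => ?_)
  have h1 : 0 ≤ t ^ 2 * w := mul_nonneg (sq_nonneg t) hw.1
  rw [norm_div, Real.norm_of_nonneg h1, Real.norm_of_nonneg (by linarith)]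
  have h2 : 0 < 1 - c := by linarith
  have h3 : t ^ 2 * w ≤ 1 := by linarith
  gcongr

omit [IsProbabilityMeasure μ] in
theorem momentGen_nonneg {w : ℝ} (hw : w ∈ rectDomain μ) : 0 ≤ momentGen μ w := by
  refine integral_nonneg_of_ae ?_
  filter_upwards [Measure.support_mem_ae (μ := μ)] with t ht
  exact div_nonneg (mul_nonneg (sq_nonneg t) hw.1) (by linarith [hw.2 t ht])

theorem momentGen_monotoneOn (hμ : ∀ᵐ t ∂μ, t ^ 2 ≤ R) :
    MonotoneOn (momentGen μ) (rectDomain μ) := by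
  intro v hv w hw hvw
  refine integral_mono_ae (integrable_momentGen hμ hv) (integrable_momentGen hμ hw) ?_
  filter_upwards [Measure.support_mem_ae (μ := μ)] with t ht
  have h1 : t ^ 2 * v ≤ t ^ 2 * w := by gcongr
  have h2 : 0 < 1 - t ^ 2 * w := by linarith [hw.2 t ht]
  have h3 : 0 ≤ t ^ 2 * w := mul_nonneg (sq_nonneg t) hw.1
  gcongr

theorem rectH_strictMonoOn {lam : ℝ} (hlam : 0 ≤ lam) (hμ : ∀ᵐ t ∂μ, t ^ 2 ≤ R) :
    StrictMonoOn (rectH lam μ) (rectDomain μ) := by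
  intro v hv w hw hvw
  have h1 := momentGen_nonneg hv
  have h2 := momentGen_nonneg hw
  have h3 := rectT_monotoneOn hlam h1 h2 (momentGen_monotoneOn hμ hv hw hvw.le)
  have h4 := rectT_pos hlam h2
  have h5 := hv.1
  calc v * rectT lam (momentGen μ v) ≤ v * rectT lam (momentGen μ w) := by gcongr
    _ < w * rectT lam (momentGen μ w) := by gcongr

/-- The difference factors as `(a - b) (lam (a + b + 1) + 1)`, and the second factor can vanish only
for `lam = 1` and `a = b = -1`. -/
theorem rectT_injOn {lam : ℝ} (h0 : 0 ≤ lam) (h1 : lam ≤ 1) : Set.InjOn (rectT lam) (Set.Ici (-1)) := by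
  intro a ha b hb hab
  simp only [Set.mem_Ici] at ha hb
  have h2 : (a - b) * (lam * (a + b + 1) + 1) = 0 := by
    unfold rectT at hab
    linarith
  rcases mul_eq_zero.1 h2 with h | h
  · linarith
  · have h3 : 0 ≤ lam * (a + b + 2) := mul_nonneg h0 (by linarith)
    have h4 : lam = 1 := by nlinarith
    subst h4
    linarith

/-- Both inverses undo themselves, since `H(w) / w = T(M(w))`. All later work uses this
parametrization instead of the definition of `C`. -/
theorem rectRTransform_rectH {lam : ℝ} (h0 : 0 ≤ lam) (h1 : lam ≤ 1) (hμ : ∀ᵐ t ∂μ, t ^ 2 ≤ R)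
    {w : ℝ} (hw : w ∈ rectDomain μ) : rectRTransform lam μ (rectH lam μ w) = momentGen μ w := by
  rcases hw.1.eq_or_lt with rfl | hw0
  · simp [rectH, rectRTransform, momentGen_zero]
  have hM := momentGen_nonneg hw
  have hT := rectT_pos h0 hM
  have hH : rectH lam μ w ≠ 0 := (mul_pos hw0 hT).ne'
  rw [rectRTransform, if_neg hH,
    (rectH_strictMonoOn h0 hμ).injOn.leftInvOn_invFunOn hw, rectH,
    mul_div_cancel_left₀ _ hw0.ne']
  exact (rectT_injOn h0 h1).leftInvOn_invFunOn (Set.mem_Ici.2 (by linarith))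

theorem continuousOn_momentGen (hR : 0 < R) (hμ : ∀ᵐ t ∂μ, t ^ 2 ≤ R) :
    ContinuousOn (momentGen μ) (Set.Iio R⁻¹) := fun _ hw =>
  (hasDerivAt_momentGen hR hμ hw).continuousAt.continuousWithinAt

theorem continuousOn_rectH (lam : ℝ) (hR : 0 < R) (hμ : ∀ᵐ t ∂μ, t ^ 2 ≤ R) :
    ContinuousOn (rectH lam μ) (Set.Iio R⁻¹) := by
  have := continuousOn_momentGen hR hμ
  unfold rectH rectT
  fun_prop

omit [IsProbabilityMeasure μ] in
theorem le_rectH {lam : ℝ} (h0 : 0 ≤ lam) {w : ℝ} (hw : w ∈ rectDomain μ) : w ≤ rectH lam μ w := by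
  have h2 := one_le_rectT h0 (momentGen_nonneg hw)
  have h3 := momentGen_nonneg hw
  unfold rectH
  nlinarith [hw.1]

/-- Intermediate values on `[0, s]`, as `H(0) = 0` and `H(s) ≥ s`. -/
theorem exists_rectH_eq {lam : ℝ} (h0 : 0 ≤ lam) (hR : 0 < R) (hμ : ∀ᵐ t ∂μ, t ^ 2 ≤ R) {s : ℝ}
    (hs0 : 0 < s) (hs : s < R⁻¹) : ∃ w, 0 < w ∧ w < R⁻¹ ∧ rectH lam μ w = s := by
  have hc : ContinuousOn (rectH lam μ) (Set.Icc 0 s) :=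
    (continuousOn_rectH lam hR hμ).mono fun w hw => hw.2.trans_lt hs
  obtain ⟨w, hw, hws⟩ := intermediate_value_Icc hs0.le hc (show s ∈ Set.Icc _ _ from
    ⟨by simpa [rectH] using hs0.le, le_rectH h0 (mem_rectDomain hR hμ hs0.le hs)⟩)
  refine ⟨w, lt_of_le_of_ne hw.1 ?_, hw.2.trans_lt hs, hws⟩
  rintro rfl
  simp [rectH] at hws
  linarith

/-- The integral of `log (T x) - log (T y)` over `0 ≤ y ≤ x`. -/
noncomputable def rectEntropy (lam x : ℝ) : ℝ :=
  x * Real.log (rectT lam x) - ∫ y in (0 : ℝ)..x, Real.log (rectT lam y)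

theorem rectEntropy_eq {lam x : ℝ} (h0 : 0 ≤ lam) (hx : 0 ≤ x) : rectEntropy lam x =
    ∫ y in (0 : ℝ)..x, (Real.log (rectT lam x) - Real.log (rectT lam y)) := by
  rw [intervalIntegral.integral_sub intervalIntegrable_const
    (intervalIntegrable_log_rectT h0 le_rfl hx), intervalIntegral.integral_const, rectEntropy]
  simp

theorem hasDerivAt_rectT (lam x : ℝ) : HasDerivAt (rectT lam) (lam * (x + 1) + (lam * x + 1)) x := by
  have := (((hasDerivAt_id x).const_mul lam).add_const 1).mul ((hasDerivAt_id x).add_const 1)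
  refine this.congr_deriv ?_
  simp

/-- The two `log T(x)` terms cancel, leaving `x T'(x) / T(x)`. -/
theorem hasDerivAt_rectEntropy {lam x : ℝ} (h0 : 0 ≤ lam) (hx : 0 ≤ x) :
    HasDerivAt (rectEntropy lam) (x * ((lam * (x + 1) + (lam * x + 1)) / rectT lam x)) x := by
  have hT := rectT_pos h0 hx
  have h1 : HasDerivAt (fun x => ∫ y in (0 : ℝ)..x, Real.log (rectT lam y))
      (Real.log (rectT lam x)) x := by
    refine intervalIntegral.integral_hasDerivAt_right
      (intervalIntegrable_log_rectT h0 le_rfl hx) ?_ ?_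
    · refine (Measurable.stronglyMeasurable ?_).stronglyMeasurableAtFilter
      unfold rectT
      fun_prop
    · exact (hasDerivAt_rectT lam x).continuousAt.log hT.ne'
  have h2 := ((hasDerivAt_id x).mul ((hasDerivAt_rectT lam x).log hT.ne')).sub h1
  refine h2.congr_deriv ?_
  simp

/-- Substitute `t = √H(v)`. Then `C(t²) dt / t = M dH / (2 H)`, and as `H = v T(M)` this is `(M / v
+ M T'(M) M' / T(M)) dv / 2`, the differential of potential plus half the entropy. -/
theorem rectLimit_integral {lam : ℝ} (h0 : 0 ≤ lam) (h1 : lam ≤ 1) (hR : 0 < R)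
    (hμ : ∀ᵐ t ∂μ, t ^ 2 ≤ R) {w : ℝ} (hw0 : 0 < w) (hw : w < R⁻¹) :
    IntervalIntegrable (fun t => rectRTransform lam μ (t ^ 2) / t) volume 0
      (Real.sqrt (rectH lam μ w)) ∧
    ∫ t in (0 : ℝ)..Real.sqrt (rectH lam μ w), rectRTransform lam μ (t ^ 2) / t =
      logPotential μ w + rectEntropy lam (momentGen μ w) / 2 := by
  set M := momentGen μ with hM
  set H := rectH lam μ with hH
  set J : ℝ → ℝ := fun v => logPotential μ v + rectEntropy lam (M v) / 2 with hJ
  have hdom : ∀ {v}, 0 ≤ v → v ≤ w → v ∈ rectDomain μ := fun hv0 hv =>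
    mem_rectDomain hR hμ hv0 (hv.trans_lt hw)
  have hM0 : ∀ {v}, 0 ≤ v → v ≤ w → 0 ≤ M v := fun hv0 hv => momentGen_nonneg (hdom hv0 hv)
  have hHpos : ∀ {v}, 0 < v → v ≤ w → 0 < H v := fun hv0 hv =>
    hv0.trans_le (le_rectH h0 (hdom hv0.le hv))
  set M' : ℝ → ℝ := fun v => ∫ t, t ^ 2 / (1 - t ^ 2 * v) ^ 2 ∂μ
  have hM'0 : ∀ v, 0 ≤ M' v := fun v => integral_nonneg fun t => by positivity
  set T' : ℝ → ℝ := fun x => lam * (x + 1) + (lam * x + 1)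
  have hH' : ∀ v, v < R⁻¹ → HasDerivAt H (rectT lam (M v) + v * (T' (M v) * M' v)) v := by
    intro v hv
    have := (hasDerivAt_id v).mul ((hasDerivAt_rectT lam (M v)).comp v
      (hasDerivAt_momentGen hR hμ hv))
    refine this.congr_deriv ?_
    simp [T', M', M]
  have hJd : ∀ v, 0 ≤ v → v ≤ w → HasDerivAt J ((∫ t, t ^ 2 / (1 - t ^ 2 * v) ∂μ) / 2 +
      M v * (T' (M v) / rectT lam (M v)) * M' v / 2) v := by
    intro v hv0 hv
    exact (hasDerivAt_logPotential hR hμ (hv.trans_lt hw)).add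
      (((hasDerivAt_rectEntropy h0 (hM0 hv0 hv)).comp v
        (hasDerivAt_momentGen hR hμ (hv.trans_lt hw))).div_const 2)
  have hJc : ContinuousOn J (Set.Icc 0 w) := fun v hv =>
    (hJd v hv.1 hv.2).continuousAt.continuousWithinAt
  set f : ℝ → ℝ := fun v => Real.sqrt (H v)
  set f' : ℝ → ℝ := fun v => (rectT lam (M v) + v * (T' (M v) * M' v)) / (2 * Real.sqrt (H v))
  have hfd : ∀ v ∈ Set.Ioo 0 w, HasDerivWithinAt f (f' v) (Set.Ioo 0 w) v := fun v hv =>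
    ((hH' v (hv.2.trans hw)).sqrt (hHpos hv.1 hv.2.le).ne').hasDerivWithinAt
  have hfmono : StrictMonoOn f (Set.Icc 0 w) := fun u hu v hv huv =>
    Real.sqrt_lt_sqrt (by
      have := le_rectH h0 (hdom hu.1 hu.2)
      exact hu.1.trans this) (rectH_strictMonoOn h0 hμ (hdom hu.1 hu.2) (hdom hv.1 hv.2) huv)
  have hfinj : Set.InjOn f (Set.Ioo 0 w) := (hfmono.mono Set.Ioo_subset_Icc_self).injOn
  have hf0 : f 0 = 0 := by simp [f, hH, rectH]
  have hfc : ContinuousOn f (Set.Icc 0 w) := Real.continuous_sqrt.comp_continuousOn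
    ((continuousOn_rectH lam hR hμ).mono fun v hv => hv.2.trans_lt hw)
  have hfw : 0 < f w := Real.sqrt_pos.2 (hHpos hw0 le_rfl)
  have himg : f '' Set.Ioo 0 w = Set.Ioo 0 (f w) := by
    refine Set.Subset.antisymm ?_ ?_
    · rintro _ ⟨v, hv, rfl⟩
      have hv' := Set.Ioo_subset_Icc_self hv
      refine ⟨?_, hfmono hv' (Set.right_mem_Icc.2 hw0.le) hv.2⟩
      rw [← hf0]
      exact hfmono (Set.left_mem_Icc.2 hw0.le) hv' hv.1
    · have := intermediate_value_Ioo hw0.le hfc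
      rwa [hf0] at this
  set g : ℝ → ℝ := fun t => rectRTransform lam μ (t ^ 2) / t
  have hgf : ∀ v ∈ Set.Ioo 0 w, |f' v| • g (f v) = (∫ t, t ^ 2 / (1 - t ^ 2 * v) ∂μ) / 2 +
      M v * (T' (M v) / rectT lam (M v)) * M' v / 2 := by
    intro v hv
    have hvH := hHpos hv.1 hv.2.le
    have hvM := hM0 hv.1.le hv.2.le
    have hs := Real.sqrt_pos.2 hvH
    have hT := rectT_pos h0 hvM
    have hv0 := hv.1
    have hT' : 0 ≤ T' (M v) := by simp only [T']; positivity
    have hf'0 : 0 ≤ f' v := by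
      have := hM'0 v
      simp only [f']; positivity
    have hI : ∫ t, t ^ 2 / (1 - t ^ 2 * v) ∂μ = M v / v := by
      rw [hM, momentGen_eq_mul, mul_div_cancel_left₀ _ hv0.ne']
    have hg : g (f v) = M v / Real.sqrt (H v) := by
      simp only [g, f]
      rw [Real.sq_sqrt hvH.le, hH, rectRTransform_rectH h0 h1 hμ (hdom hv.1.le hv.2.le)]
    rw [abs_of_nonneg hf'0, hg, hI, smul_eq_mul]
    simp only [f']
    rw [div_mul_div_comm, mul_assoc 2, Real.mul_self_sqrt hvH.le,
      show H v = v * rectT lam (M v) from rfl]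
    field_simp
  have hJnn : ∀ v ∈ Set.Ioo 0 w, 0 ≤ (∫ t, t ^ 2 / (1 - t ^ 2 * v) ∂μ) / 2 +
      M v * (T' (M v) / rectT lam (M v)) * M' v / 2 := by
    intro v hv
    rw [← hgf v hv]
    refine mul_nonneg (abs_nonneg _) (div_nonneg ?_ (Real.sqrt_nonneg _))
    simp only [f]
    rw [Real.sq_sqrt (hHpos hv.1 hv.2.le).le, hH, rectRTransform_rectH h0 h1 hμ (hdom hv.1.le hv.2.le)]
    exact hM0 hv.1.le hv.2.le
  have hJd' := fun v (hv : v ∈ Set.Ioo 0 w) => hJd v hv.1.le hv.2.le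
  -- Integrability comes from nonnegativity of the derivative of a function continuous up to the
  -- endpoints, so `C(t²) / t` needs no estimate near `0`.
  have hJint := intervalIntegral.integrableOn_deriv_of_nonneg hJc hJd' hJnn
  have hJint' := (intervalIntegrable_iff_integrableOn_Ioc_of_le hw0.le).2 hJint
  have hFTC := intervalIntegral.integral_eq_sub_of_hasDerivAt_of_le hw0.le hJc hJd' hJint'
  have hJ0 : J 0 = 0 := by
    simp [hJ, hM, logPotential_zero, momentGen_zero, rectEntropy]
  constructor
  · rw [intervalIntegrable_iff_integrableOn_Ioo_of_le hfw.le, ← himg,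
      integrableOn_image_iff_integrableOn_abs_deriv_smul measurableSet_Ioo hfd hfinj,
      integrableOn_congr_fun hgf measurableSet_Ioo]
    exact hJint.mono_set Set.Ioo_subset_Ioc_self
  · rw [intervalIntegral.integral_of_le hfw.le, integral_Ioc_eq_integral_Ioo, ← himg,
      integral_image_eq_integral_abs_deriv_smul measurableSet_Ioo hfd hfinj,
      setIntegral_congr_fun measurableSet_Ioo hgf, ← integral_Ioc_eq_integral_Ioo,
      ← intervalIntegral.integral_of_le hw0.le, hFTC, hJ0, sub_zero]

end RectangularTransform

/-! ### The Cauchy transform and the `R`-transform -/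

section CauchyTransform

variable {ν : Measure ℝ} [IsProbabilityMeasure ν]

theorem integral_pos_of_ae_pos {f : ℝ → ℝ} (hf : Integrable f ν) (h : ∀ᵐ t ∂ν, 0 < f t) :
    0 < ∫ t, f t ∂ν := by
  have h0 : 0 ≤ᵐ[ν] f := h.mono fun t ht => ht.le
  refine lt_of_le_of_ne (integral_nonneg_of_ae h0) fun h1 => ?_
  obtain ⟨t, ht, ht'⟩ := (h.and ((integral_eq_zero_iff_of_nonneg_ae h0 hf).1 h1.symm)).exists
  exact ht.ne' ht'

omit [IsProbabilityMeasure ν] in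
theorem lt_or_gt_of_notMem_convexHull {z : ℝ} (hz : z ∉ convexHull ℝ ν.support) :
    (∀ s ∈ ν.support, s < z) ∨ ∀ s ∈ ν.support, z < s := by
  by_contra! h
  obtain ⟨⟨s, hs, hzs⟩, t, ht, htz⟩ := h
  exact hz ((convex_convexHull ℝ ν.support).ordConnected.out (subset_convexHull ℝ _ ht)
    (subset_convexHull ℝ _ hs) ⟨htz, hzs⟩)

theorem integrable_one_div_sub (hc : IsCompact ν.support) {z : ℝ}
    (hz : z ∉ convexHull ℝ ν.support) : Integrable (fun t => 1 / (z - t)) ν := by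
  have hne : ν.support.Nonempty := Measure.nonempty_support (IsProbabilityMeasure.ne_zero ν)
  obtain ⟨s, hs, hmin⟩ := hc.exists_isMinOn hne (f := fun t : ℝ => |z - t|) (by fun_prop)
  have hpos : 0 < |z - s| := abs_pos.2 (sub_ne_zero.2 fun h =>
    hz (h ▸ subset_convexHull ℝ _ hs))
  refine Integrable.of_bound (Measurable.aestronglyMeasurable (by fun_prop)) (1 / |z - s|) ?_
  filter_upwards [Measure.support_mem_ae (μ := ν)] with t ht
  rw [norm_div, norm_one, Real.norm_eq_abs]
  exact one_div_le_one_div_of_le hpos (hmin ht)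

/-- The transform is strictly decreasing on each side of the support, and it is negative on the left
and positive on the right. -/
theorem cauchyTransform_injOn (hc : IsCompact ν.support) :
    Set.InjOn (cauchyTransform ν) (convexHull ℝ ν.support)ᶜ := by
  have key : ∀ z₁ ∈ (convexHull ℝ ν.support)ᶜ, ∀ z₂ ∈ (convexHull ℝ ν.support)ᶜ, z₁ < z₂ →
      cauchyTransform ν z₁ ≠ cauchyTransform ν z₂ := by
    intro z₁ h₁ z₂ h₂ hlt heq
    have i₁ := integrable_one_div_sub hc h₁
    have i₂ := integrable_one_div_sub hc h₂
    have hae := Measure.support_mem_ae (μ := ν)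
    have hsame : (∀ s ∈ ν.support, 0 < (z₁ - s) * (z₂ - s)) → False := by
      intro h
      have h3 := integral_pos_of_ae_pos (i₁.sub i₂) (by
        filter_upwards [hae] with t ht
        have h4 := h t ht
        have h5 : z₁ - t ≠ 0 := left_ne_zero_of_mul h4.ne'
        have h6 : z₂ - t ≠ 0 := right_ne_zero_of_mul h4.ne'
        have h7 : 1 / (z₁ - t) - 1 / (z₂ - t) = (z₂ - z₁) / ((z₁ - t) * (z₂ - t)) := by
          field_simp
          ring
        rw [Pi.sub_apply, h7]
        exact div_pos (by linarith) h4)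
      simp only [Pi.sub_apply] at h3
      rw [integral_sub i₁ i₂] at h3
      unfold cauchyTransform at heq
      linarith
    rcases lt_or_gt_of_notMem_convexHull h₁ with a₁ | a₁
    · exact hsame fun s hs => by nlinarith [a₁ s hs]
    · rcases lt_or_gt_of_notMem_convexHull h₂ with a₂ | a₂
      · have h3 := integral_pos_of_ae_pos (i₂.sub i₁) (by
          filter_upwards [hae] with t ht
          have h4 : 0 < 1 / (z₂ - t) := one_div_pos.2 (by linarith [a₂ t ht])
          have h5 : 1 / (z₁ - t) < 0 := one_div_neg.2 (by linarith [a₁ t ht])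
          rw [Pi.sub_apply]
          linarith)
        simp only [Pi.sub_apply] at h3
        rw [integral_sub i₂ i₁] at h3
        unfold cauchyTransform at heq
        linarith
      · exact hsame fun s hs => by nlinarith [a₂ s hs, a₁ s hs]
  intro z₁ h₁ z₂ h₂ heq
  rcases lt_trichotomy z₁ z₂ with h | h | h
  · exact absurd heq (key z₁ h₁ z₂ h₂ h)
  · exact h
  · exact absurd heq.symm (key z₂ h₂ z₁ h₁ h)

omit [IsProbabilityMeasure ν] in
theorem support_subset_Icc {a b : ℝ} (h : ∀ᵐ t ∂ν, t ∈ Set.Icc a b) : ν.support ⊆ Set.Icc a b :=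
  Measure.support_subset_of_isClosed isClosed_Icc h

theorem rTransform_cauchyTransform {a b z : ℝ} (h : ∀ᵐ t ∂ν, t ∈ Set.Icc a b)
    (hz : z ∉ Set.Icc a b) (h0 : cauchyTransform ν z ≠ 0) :
    rTransform ν (cauchyTransform ν z) = z - 1 / cauchyTransform ν z := by
  have hsub := support_subset_Icc h
  have hc : IsCompact ν.support := isCompact_Icc.of_isClosed_subset Measure.isClosed_support hsub
  have hz' : z ∈ (convexHull ℝ ν.support)ᶜ := fun hm =>
    hz (convexHull_min hsub (convex_Icc a b) hm)
  rw [rTransform, if_neg h0, (cauchyTransform_injOn hc).leftInvOn_invFunOn hz']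

end CauchyTransform

/-! ### The rectangular `R`-transform for ratios `0` and `1` -/

section Identification

variable {μ : Measure ℝ} [IsProbabilityMeasure μ] {R : ℝ}

theorem integral_one_div_eq (hμ : ∀ᵐ t ∂μ, t ^ 2 ≤ R) {w : ℝ} (hw : w ∈ rectDomain μ) :
    ∫ t, 1 / (1 - t ^ 2 * w) ∂μ = momentGen μ w + 1 := by
  have h1 : (momentGen μ w + 1) = ∫ t, (t ^ 2 * w / (1 - t ^ 2 * w) + 1) ∂μ := by
    rw [integral_add (integrable_momentGen hμ hw) (integrable_const _), momentGen]
    simp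
  rw [h1]
  refine integral_congr_ae ?_
  filter_upwards [Measure.support_mem_ae (μ := μ)] with t ht
  have h2 : 1 - t ^ 2 * w ≠ 0 := by linarith [hw.2 t ht]
  field_simp
  ring

instance isProbabilityMeasure_squareLaw : IsProbabilityMeasure (squareLaw μ) :=
  Measure.isProbabilityMeasure_map (by fun_prop)

/-- For ratio `0`, `H(w) = w (M(w) + 1)` is the Cauchy transform of the squared law at `1 / w`. If
`t² = H(w)`, then `t R(t²) = t / w - 1 / t = M(w) / t`. -/
theorem rectRTransform_zero_div_eq (hR : 0 < R) (hμ : ∀ᵐ t ∂μ, t ^ 2 ≤ R) {t : ℝ}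
    (ht : t ^ 2 < R⁻¹) :
    rectRTransform 0 μ (t ^ 2) / t = t * rTransform (squareLaw μ) (t ^ 2) := by
  rcases eq_or_ne t 0 with rfl | ht0
  · simp
  have hs0 : 0 < t ^ 2 := by positivity
  obtain ⟨w, hw0, hw, hH⟩ := exists_rectH_eq le_rfl hR hμ hs0 ht
  have hwd := mem_rectDomain hR hμ hw0.le hw
  have hG : cauchyTransform (squareLaw μ) (1 / w) = t ^ 2 := by
    rw [cauchyTransform, squareLaw, integral_map (by fun_prop)
      (Measurable.aestronglyMeasurable (by fun_prop)), ← hH, rectH, rectT, zero_mul, zero_add,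
      one_mul, ← integral_one_div_eq hμ hwd, ← integral_const_mul]
    congr 1
    ext s
    have h1 : 1 / w - s ^ 2 = (1 - s ^ 2 * w) / w := by field_simp
    rw [h1, one_div_div]
    ring
  have hae : ∀ᵐ s ∂(squareLaw μ), s ∈ Set.Icc 0 R := by
    exact (ae_map_iff (p := fun s => s ∈ Set.Icc 0 R) (by fun_prop) measurableSet_Icc).2
      (hμ.mono fun s hs => ⟨sq_nonneg s, hs⟩)
  have hz : 1 / w ∉ Set.Icc 0 R := fun h => by
    have := h.2
    rw [one_div] at this
    exact absurd (inv_le_of_inv_le₀ hw0 this) (not_le.2 hw)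
  have h1 := rTransform_cauchyTransform hae hz (by rw [hG]; exact hs0.ne')
  rw [hG] at h1
  have h2 := rectRTransform_rectH le_rfl zero_le_one hμ hwd
  rw [hH] at h2
  have h3 : t ^ 2 = w * (momentGen μ w + 1) := by
    rw [← hH, rectH, rectT]; ring
  rw [h1, h2]
  field_simp
  linear_combination -h3

instance isProbabilityMeasure_symmetrization : IsProbabilityMeasure (symmetrization μ) := by
  constructor
  have : IsProbabilityMeasure (μ.map fun t => -t) := Measure.isProbabilityMeasure_map (by fun_prop)
  simp only [symmetrization, Measure.smul_apply, Measure.add_apply, measure_univ, smul_eq_mul]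
  rw [one_add_one_eq_two]
  exact ENNReal.inv_mul_cancel (by norm_num) (by norm_num)

omit [IsProbabilityMeasure μ] in
theorem integral_symmetrization {f : ℝ → ℝ} (hf : Measurable f) (h1 : Integrable f μ)
    (h2 : Integrable (fun t => f (-t)) μ) :
    ∫ t, f t ∂(symmetrization μ) = ((∫ t, f t ∂μ) + ∫ t, f (-t) ∂μ) / 2 := by
  rw [symmetrization, integral_smul_measure, integral_add_measure h1
    ((integrable_map_measure hf.aestronglyMeasurable (by fun_prop)).2 h2),
    integral_map (by fun_prop) hf.aestronglyMeasurable]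
  simp
  ring

omit [IsProbabilityMeasure μ] in
theorem ae_symmetrization {p : ℝ → Prop} (hp : MeasurableSet {t | p t}) (h1 : ∀ᵐ t ∂μ, p t)
    (h2 : ∀ᵐ t ∂μ, p (-t)) : ∀ᵐ t ∂(symmetrization μ), p t := by
  refine Measure.ae_smul_measure (ae_add_measure_iff.2 ⟨h1, ?_⟩) _
  rwa [ae_map_iff (by fun_prop) hp]

/-- For ratio `1`, `t² = H(w) = w (M(w) + 1)²`. Averaging `1 / (z - s)` and `1 / (z + s)` gives `w z
/ (1 - s² w)` when `w z² = 1`, so the transform at `z = (M(w) + 1) / t` equals `t`, and `z - 1 / t =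
M(w) / t`. The sign of `z` is that of `t`. -/
theorem rectRTransform_one_div_eq (hR : 0 < R) (hμ : ∀ᵐ t ∂μ, t ^ 2 ≤ R) {t : ℝ}
    (ht : t ^ 2 < R⁻¹) :
    rectRTransform 1 μ (t ^ 2) / t = rTransform (symmetrization μ) t := by
  have habs : ∀ s : ℝ, s ^ 2 ≤ R → |s| ≤ Real.sqrt R := fun s hs => by
    rw [← Real.sqrt_sq_eq_abs]; exact Real.sqrt_le_sqrt hs
  rcases eq_or_ne t 0 with rfl | ht0
  -- At `t = 0` the left side is `0` by the convention on division and the right side is the mean of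
  -- a symmetric law.
  · rw [rTransform, if_pos rfl, integral_symmetrization (by fun_prop)
      (integrable_of_ae_sq_le hμ (by fun_prop) habs)
      (integrable_of_ae_sq_le hμ (by fun_prop) (C := Real.sqrt R) fun s hs => by
        rw [abs_neg]; exact habs s hs), integral_neg]
    simp
  have hs0 : 0 < t ^ 2 := by positivity
  obtain ⟨w, hw0, hw, hH⟩ := exists_rectH_eq zero_le_one hR hμ hs0 ht
  have hwd := mem_rectDomain hR hμ hw0.le hw
  have hM := momentGen_nonneg hwd
  have h2 := rectRTransform_rectH zero_le_one le_rfl hμ hwd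
  rw [hH] at h2
  have hae : ∀ᵐ s ∂(symmetrization μ), s ∈ Set.Icc (-Real.sqrt R) (Real.sqrt R) :=
    ae_symmetrization measurableSet_Icc (hμ.mono fun s hs => abs_le.1 (habs s hs))
      (hμ.mono fun s hs => abs_le.1 (by rw [abs_neg]; exact habs s hs))
  have hG : ∀ z : ℝ, w * z ^ 2 = 1 →
      cauchyTransform (symmetrization μ) z = w * z * (momentGen μ w + 1) ∧
        z ∉ Set.Icc (-Real.sqrt R) (Real.sqrt R) := by
    intro z hz
    have hzR : R < z ^ 2 := by
      rw [lt_inv_comm₀ hw0 hR] at hw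
      rwa [eq_inv_of_mul_eq_one_right hz]
    have hz' : Real.sqrt R < |z| := by
      rw [← Real.sqrt_sq_eq_abs]; exact Real.sqrt_lt_sqrt hR.le hzR
    have hbd : ∀ s : ℝ, s ^ 2 ≤ R → |1 / (z - s)| ≤ 1 / (|z| - Real.sqrt R) := by
      intro s hs
      rw [abs_div, abs_one]
      refine one_div_le_one_div_of_le (by linarith) ?_
      linarith [abs_sub_abs_le_abs_sub z s, habs s hs]
    have hi1 := integrable_of_ae_sq_le hμ (f := fun s => 1 / (z - s)) (by fun_prop) hbd
    have hi2 := integrable_of_ae_sq_le hμ (f := fun s => 1 / (z - -s)) (by fun_prop)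
      (fun s hs => hbd (-s) (by rwa [neg_sq]))
    refine ⟨?_, fun h => (abs_le.2 h).not_gt hz'⟩
    rw [cauchyTransform, integral_symmetrization (by fun_prop) hi1 hi2, ← integral_add hi1 hi2,
      ← integral_one_div_eq hμ hwd, ← integral_const_mul, ← integral_div]
    refine integral_congr_ae (hμ.mono fun s hs => ?_)
    have a1 : z ^ 2 - s ^ 2 ≠ 0 := by linarith
    have a2 : z - s ≠ 0 := fun h => a1 (by rw [sq_sub_sq, h, mul_zero])
    have a3 : z + s ≠ 0 := fun h => a1 (by rw [sq_sub_sq, h, zero_mul])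
    have a4 : 1 - s ^ 2 * w = w * ((z - s) * (z + s)) := by linear_combination -hz
    simp only [a4, sub_neg_eq_add]
    field_simp
    ring
  have h3 : t ^ 2 = w * (momentGen μ w + 1) ^ 2 := by
    rw [← hH, rectH, rectT]; ring
  have h4 : 0 < momentGen μ w + 1 := by linarith
  -- the point `z` at which the Cauchy transform takes the value `t`
  have hz : w * ((momentGen μ w + 1) / t) ^ 2 = 1 := by
    rw [div_pow, ← mul_div_assoc, ← h3, div_self hs0.ne']
  obtain ⟨h5, h6⟩ := hG _ hz
  have h7 : w * ((momentGen μ w + 1) / t) * (momentGen μ w + 1) = t := by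
    field_simp
    linear_combination -h3
  rw [h7] at h5
  have h1 := rTransform_cauchyTransform hae h6 (by rw [h5]; exact ht0)
  rw [h5] at h1
  rw [h1, h2]
  field_simp
  ring

end Identification

/-! ### The limit of the spherical integrals -/

section RectLimit

variable {μ : Measure ℝ} [IsProbabilityMeasure μ] {R : ℝ}

/-- The integrand is odd, so its integral from `0` to `a` depends only on `|a|`. -/
theorem rectRTransform_integral {lam : ℝ} (h0 : 0 ≤ lam) (h1 : lam ≤ 1) (hR : 0 < R)
    (hμ : ∀ᵐ t ∂μ, t ^ 2 ≤ R) {w a : ℝ} (hw0 : 0 < w) (hw : w < R⁻¹)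
    (ha : rectH lam μ w = a ^ 2) :
    IntervalIntegrable (fun t => rectRTransform lam μ (t ^ 2) / t) volume 0 a ∧
    ∫ t in (0 : ℝ)..a, rectRTransform lam μ (t ^ 2) / t =
      logPotential μ w + rectEntropy lam (momentGen μ w) / 2 := by
  obtain ⟨h2, h3⟩ := rectLimit_integral h0 h1 hR hμ hw0 hw
  rw [ha, Real.sqrt_sq_eq_abs] at h2 h3
  rcases abs_choice a with h | h
  · rw [h] at h2 h3
    exact ⟨h2, h3⟩
  · rw [h] at h2 h3
    constructor
    · rw [IntervalIntegrable.iff_comp_neg]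
      simp only [neg_sq, div_neg, neg_zero]
      exact h2.neg
    · have h4 := intervalIntegral.integral_comp_neg (a := 0) (b := -a)
        fun t => rectRTransform lam μ (t ^ 2) / t
      simp only [neg_sq, div_neg, intervalIntegral.integral_neg, neg_neg, neg_zero] at h4
      rw [intervalIntegral.integral_symm 0 a, neg_inj] at h4
      rw [← h3, h4]

theorem intervalIntegrable_rectRTransform {lam : ℝ} (h0 : 0 ≤ lam) (h1 : lam ≤ 1) (hR : 0 < R)
    (hμ : ∀ᵐ t ∂μ, t ^ 2 ≤ R) {a : ℝ} (ha : a ^ 2 < R⁻¹) :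
    IntervalIntegrable (fun t => rectRTransform lam μ (t ^ 2) / t) volume 0 a := by
  rcases eq_or_ne a 0 with rfl | ha0
  · exact IntervalIntegrable.refl
  obtain ⟨w, hw0, hw, hH⟩ := exists_rectH_eq h0 hR hμ (show 0 < a ^ 2 by positivity) ha
  exact (rectRTransform_integral h0 h1 hR hμ hw0 hw hH).1

theorem integral_congr_of_sq_lt {f g : ℝ → ℝ} {r a : ℝ} (ha : a ^ 2 < r)
    (h : ∀ t, t ^ 2 < r → f t = g t) (hf : IntervalIntegrable f volume 0 a) :
    IntervalIntegrable g volume 0 a ∧ ∫ t in (0 : ℝ)..a, f t = ∫ t in (0 : ℝ)..a, g t := by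
  have hsq : ∀ t ∈ Set.uIcc 0 a, f t = g t := fun t ht => by
    refine h t (lt_of_le_of_lt ?_ ha)
    rw [Set.mem_uIcc] at ht
    rcases ht with ht | ht <;> nlinarith
  exact ⟨hf.congr fun t ht => hsq t (Set.uIoc_subset_uIcc ht),
    intervalIntegral.integral_congr hsq⟩

theorem continuousOn_rectLimit {β lam r : ℝ} (hβ : 0 < β) (h0 : 0 ≤ lam) (h1 : lam ≤ 1)
    (hR : 0 < R) (hμ : ∀ᵐ t ∂μ, t ^ 2 ≤ R)
    (hr : ∀ θ ∈ Set.Ioo (-r) r, (θ / β) ^ 2 < R⁻¹) :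
    ContinuousOn (rectLimit β lam μ) (Set.Ico 0 r) := by
  intro x hx
  obtain ⟨y, hxy, hyr⟩ := exists_between hx.2
  have hy0 : 0 ≤ y := hx.1.trans hxy.le
  have hi := intervalIntegrable_rectRTransform h0 h1 hR hμ (hr y ⟨by linarith, hyr⟩)
  have hyb : 0 ≤ y / β := by positivity
  have hc := intervalIntegral.continuousOn_primitive_interval' hi Set.left_mem_uIcc
  have hc' : ContinuousOn (rectLimit β lam μ) (Set.Icc 0 y) := by
    refine continuousOn_const.mul (hc.comp (f := fun θ => θ / β) (by fun_prop) fun z hz => ?_)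
    rw [Set.uIcc_of_le hyb]
    exact ⟨div_nonneg hz.1 hβ.le, div_le_div_of_nonneg_right hz.2 hβ.le⟩
  refine (hc' x ⟨hx.1, hxy.le⟩).mono_of_mem_nhdsWithin ?_
  filter_upwards [self_mem_nhdsWithin, nhdsWithin_le_nhds (Iio_mem_nhds hxy)] with z hz hzy
  exact ⟨hz.1, le_of_lt hzy⟩

end RectLimit

/-! ### From pointwise to locally uniform convergence -/

section UniformConvergence

/-- Pointwise convergence of functions that increase with `|x|` to a continuous function is locally
uniform. -/
theorem tendstoLocallyUniformlyOn_of_monotone_abs {φ : ℕ → ℝ → ℝ} {f : ℝ → ℝ} {r : ℝ}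
    (hmono : ∀ᶠ n in atTop, ∀ x y, |x| ≤ |y| → φ n x ≤ φ n y)
    (hlim : ∀ x ∈ Set.Ioo (-r) r, Tendsto (fun n => φ n x) atTop (𝓝 (f x)))
    (hc : ContinuousOn f (Set.Ico 0 r)) :
    TendstoLocallyUniformlyOn φ f atTop (Set.Ioo (-r) r) := by
  rw [Metric.tendstoLocallyUniformlyOn_iff]
  intro ε hε x hx
  have hxr : |x| < r := abs_lt.2 hx
  have hcx := Metric.continuousWithinAt_iff.1 (hc |x| ⟨abs_nonneg x, hxr⟩) (ε / 4) (by positivity)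
  obtain ⟨δ, hδ, hδf⟩ := hcx
  -- The limit inherits evenness from the `φ n`, so continuity on `[0, r)` suffices.
  have habs : ∀ y ∈ Set.Ioo (-r) r, f |y| = f y := by
    intro y hy
    have hy' : |y| ∈ Set.Ioo (-r) r := by
      have := abs_lt.2 hy
      exact ⟨by linarith [abs_nonneg y], this⟩
    refine tendsto_nhds_unique (hlim _ hy') ((hlim y hy).congr' ?_)
    filter_upwards [hmono] with n hn
    exact le_antisymm (hn _ _ (by simp)) (hn _ _ (by simp))
  set η := min (δ / 2) ((r - |x|) / 2)
  have hη : 0 < η := lt_min (by linarith) (by linarith)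
  have hη1 : η ≤ δ / 2 := min_le_left _ _
  have hη2 : η ≤ (r - |x|) / 2 := min_le_right _ _
  -- For `y` near `x`, `φ n y` is squeezed between `φ n a` and `φ n c`; only these two points need
  -- pointwise convergence.
  set a := max 0 (|x| - η)
  set c := |x| + η
  have ha0 : 0 ≤ a := le_max_left _ _
  have ha1 : |x| - η ≤ a := le_max_right _ _
  have ha2 : a ≤ |x| := max_le (abs_nonneg x) (by linarith)
  have hc0 : 0 ≤ c := by positivity
  have hfd : ∀ y, 0 ≤ y → |x| - η ≤ y → y ≤ |x| + η → |f y - (f |x|)| < ε / 4 := by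
    intro y hy0 hy1 hy2
    have := hδf (x := y) ⟨hy0, by linarith⟩
      (by rw [Real.dist_eq]; exact lt_of_le_of_lt (abs_le.2 ⟨by linarith, by linarith⟩)
            (by linarith : η < δ))
    rwa [Real.dist_eq] at this
  refine ⟨Metric.ball x η, mem_nhdsWithin_of_mem_nhds (Metric.ball_mem_nhds x hη), ?_⟩
  have hla := Metric.tendsto_nhds.1 (hlim a ⟨by linarith [abs_nonneg x], by linarith⟩) (ε / 4)
    (by positivity)
  have hlc := Metric.tendsto_nhds.1 (hlim c ⟨by linarith [abs_nonneg x], by linarith⟩) (ε / 4)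
    (by positivity)
  filter_upwards [hmono, hla, hlc] with n hn hna hnc y hy
  rw [Metric.mem_ball, Real.dist_eq] at hy
  have hy1 := abs_lt.1 ((abs_abs_sub_abs_le_abs_sub y x).trans_lt hy)
  have hay : a ≤ |y| := max_le (abs_nonneg y) (by linarith)
  have hyc : |y| ≤ c := by simp only [c]; linarith
  have hyr : y ∈ Set.Ioo (-r) r := abs_lt.1 (by linarith)
  have h1 := hn a y (by rwa [abs_of_nonneg ha0])
  have h2 := hn y c (by rwa [abs_of_nonneg hc0])
  have h3 := abs_lt.1 (hfd a ha0 ha1 (by linarith))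
  have h4 := abs_lt.1 (hfd c hc0 (by linarith) le_rfl)
  have h5 := abs_lt.1 (hfd |y| (abs_nonneg y) (by linarith) (by linarith))
  rw [habs y hyr] at h5
  rw [Real.dist_eq] at hna hnc
  have h6 := abs_lt.1 hna
  have h7 := abs_lt.1 hnc
  rw [Real.dist_eq, abs_lt]
  constructor <;> linarith

end UniformConvergence

/-! ### Convergence of the spherical integrals -/

section SphericalIntegral

variable {𝕜 : Type*} [RCLike 𝕜]

theorem singVal_nonneg {n m : ℕ} (M : Matrix (Fin n) (Fin m) 𝕜) (k : Fin n) : 0 ≤ singVal M k :=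
  LinearMap.singularValues_nonneg _ _

theorem integral_singularLaw {n m : ℕ} (M : Matrix (Fin n) (Fin m) 𝕜) (f : ℝ →ᵇ ℝ) :
    ∫ t, f t ∂(singularLaw M) = 1 / (n : ℝ) * ∑ k, f (singVal M k) := by
  rw [singularLaw, integral_smul_measure, integral_finsetSum_measure
    fun k _ => integrable_dirac (by simp)]
  simp

theorem sphericalIntegral_single {n m : ℕ} (M : Matrix (Fin n) (Fin m) 𝕜) (i : Fin m) (j : Fin n)
    (θ : ℝ) : sphericalIntegral (Matrix.single i j 1) M θ =
      1 / (n : ℝ) * Real.log (entryLaplace M j i (Real.sqrt ((n : ℝ) * (m : ℝ)) * θ)) := by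
  rw [sphericalIntegral, entryLaplace]
  congr 2
  refine integral_congr_ae (Eventually.of_forall fun p => ?_)
  simp only [reEntry]
  congr 3
  rw [Matrix.mul_assoc, Matrix.mul_assoc, Matrix.trace_single_mul, one_smul, Matrix.mul_assoc]

/-- The power series of the spherical integral. -/
theorem exists_coeff_sphericalIntegral {n m : ℕ} (hnm : n ≤ m)
    {M : Matrix (Fin n) (Fin m) 𝕜} {E : Matrix (Fin m) (Fin n) 𝕜} (hE : IsElementaryMatrix E)
    {R : ℝ} (hR : 0 < R) (hM : ∀ k, singVal M k ^ 2 ≤ R) :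
    ∃ (h : ℕ → ℝ) (F : ℝ → ℝ), (∀ k, 0 ≤ h k) ∧ (∀ θ, 0 < F θ) ∧
      (∀ θ, sphericalIntegral E M θ = 1 / (n : ℝ) * Real.log (F θ)) ∧
      (∀ w ∈ Set.Ioo 0 R⁻¹, HasSum (fun k => h k * w ^ k) (Real.exp (betaIndex 𝕜 * n *
        (-(1 / 2) * (1 / (n : ℝ) * ∑ k, Real.log (1 - singVal M k ^ 2 * w)))))) ∧
      ∀ θ, HasSum (fun k => h k * ∏ i ∈ Finset.range k, ((θ / betaIndex 𝕜) ^ 2 /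
        rectT ((n : ℝ) / m) (2 / (betaIndex 𝕜 * n) * i))) (F θ) := by
  obtain ⟨i, j, rfl⟩ := hE
  have hβ := betaIndex_pos 𝕜
  have hn : (0 : ℝ) < n := by exact_mod_cast j.pos
  have hm : (0 : ℝ) < m := by exact_mod_cast i.pos
  refine ⟨entryCoeff M j i, fun θ => entryLaplace M j i (Real.sqrt ((n : ℝ) * (m : ℝ)) * θ),
    entryCoeff_nonneg M j i, fun θ => ?_, sphericalIntegral_single M i j, fun w hw => ?_,
    fun θ => ?_⟩
  · exact integral_exp_pos (integrable_haarUnitary_prod (by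
      have := continuous_reEntry M j i
      fun_prop))
  · have hlt : ∀ k, singVal M k ^ 2 * w < 1 := fun k => sq_mul_lt_one hR hw.1.le hw.2 (hM k)
    convert hasSum_entryCoeff M j i hw.1.le (fun k => by rw [mul_comm]; exact hlt k) hnm using 1
    have h1 : betaIndex 𝕜 * n * (-(1 / 2) * (1 / (n : ℝ) *
        ∑ k, Real.log (1 - singVal M k ^ 2 * w))) =
        ∑ k, Real.log (1 - singVal M k ^ 2 * w) * (-(betaIndex 𝕜 / 2)) := by
      rw [← Finset.sum_mul]
      generalize ∑ k, Real.log (1 - singVal M k ^ 2 * w) = S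
      field_simp
    rw [h1, Real.exp_sum]
    refine Finset.prod_congr rfl fun k _ => ?_
    rw [mul_comm w, Real.rpow_def_of_pos (by linarith [hlt k])]
  · convert hasSum_entryLaplace_entryCoeff M j i (Real.sqrt ((n : ℝ) * (m : ℝ)) * θ) using 2 with k
    congr 1
    rw [mul_pow, Real.sq_sqrt (by positivity), risingFactorial, risingFactorial,
      ← Finset.prod_mul_distrib, ← Finset.card_range k, ← Finset.prod_const, Finset.card_range,
      ← Finset.prod_div_distrib]
    -- The factor `√(n m)` is what makes `n m θ² / 4` over the two factors `β n / 2 + l` and `β m /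
    -- 2 + l` equal to `(θ / β)² / T(2 l / (β n))` with ratio `n / m`.
    refine Finset.prod_congr rfl fun l _ => ?_
    unfold rectT
    have : (0 : ℝ) ≤ l := Nat.cast_nonneg l
    have h1 : betaIndex 𝕜 * n / 2 + l ≠ 0 := by positivity
    have h2 : betaIndex 𝕜 * m / 2 + l ≠ 0 := by positivity
    have h3 : (n : ℝ) / m * (2 / (betaIndex 𝕜 * n) * l) + 1 =
        2 / (betaIndex 𝕜 * m) * (betaIndex 𝕜 * m / 2 + l) := by
      field_simp
      ring
    have h4 : 2 / (betaIndex 𝕜 * n) * (l : ℝ) + 1 =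
        2 / (betaIndex 𝕜 * n) * (betaIndex 𝕜 * n / 2 + l) := by
      field_simp
      ring
    rw [h3, h4]
    field_simp
    ring

/-- The integral is a power series in `θ²` with nonnegative coefficients. -/
theorem sphericalIntegral_mono {n m : ℕ} (hnm : n ≤ m)
    {M : Matrix (Fin n) (Fin m) 𝕜} {E : Matrix (Fin m) (Fin n) 𝕜} (hE : IsElementaryMatrix E)
    {x y : ℝ} (hxy : |x| ≤ |y|) : sphericalIntegral E M x ≤ sphericalIntegral E M y := by
  obtain ⟨R, hR, hMR⟩ : ∃ R : ℝ, 0 < R ∧ ∀ k, singVal M k ^ 2 ≤ R :=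
    ⟨∑ k, singVal M k ^ 2 + 1, by positivity, fun k => by
      have := Finset.single_le_sum (f := fun k => singVal M k ^ 2) (fun k _ => sq_nonneg _)
        (Finset.mem_univ k)
      linarith⟩
  obtain ⟨h, F, h0, hF0, hF, -, hFs⟩ := exists_coeff_sphericalIntegral hnm hE hR hMR
  rw [hF, hF]
  refine mul_le_mul_of_nonneg_left (Real.log_le_log (hF0 x) (hasSum_le (fun k => ?_) (hFs x)
    (hFs y))) (by positivity)
  have := h0 k
  have hβ := betaIndex_pos 𝕜
  have hT : ∀ i : ℕ, 0 < rectT ((n : ℝ) / m) (2 / (betaIndex 𝕜 * n) * i) := fun i =>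
    rectT_pos (by positivity) (by positivity)
  have h2 : (x / betaIndex 𝕜) ^ 2 ≤ (y / betaIndex 𝕜) ^ 2 := by
    rw [div_pow, div_pow]
    have := sq_le_sq.2 hxy
    gcongr
  refine mul_le_mul_of_nonneg_left (Finset.prod_le_prod (fun i _ => ?_) fun i _ => ?_) (h0 k)
  · have := hT i
    positivity
  · have := hT i
    gcongr

theorem sphericalIntegral_zero {n m : ℕ} (E : Matrix (Fin m) (Fin n) 𝕜)
    (M : Matrix (Fin n) (Fin m) 𝕜) : sphericalIntegral E M 0 = 0 := by
  simp [sphericalIntegral]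

variable {m : ℕ → ℕ} {M : ∀ n : ℕ, Matrix (Fin n) (Fin (m n)) 𝕜} {R : ℝ} {μ : Measure ℝ}
  [IsProbabilityMeasure μ]

/-- Test against the positive part of `t² - R` truncated at `1`: it integrates to zero against every
singular law with `n ≥ 1`, hence against the limit. -/
theorem ae_sq_le_of_convergesWeakly (hM : ∀ n, 1 ≤ n → ∀ k : Fin n, singVal (M n) k ^ 2 ≤ R)
    (hμ : ConvergesWeakly (fun n => singularLaw (M n)) μ) : ∀ᵐ t ∂μ, t ^ 2 ≤ R := by
  let f : ℝ →ᵇ ℝ := BoundedContinuousFunction.ofNormedAddCommGroup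
    (fun t => min 1 (max 0 (t ^ 2 - R))) (by fun_prop) 1 fun t => by
      rw [Real.norm_of_nonneg (le_min zero_le_one (le_max_left _ _))]
      exact min_le_left _ _
  have hf : ∀ t, f t = min 1 (max 0 (t ^ 2 - R)) := fun t => rfl
  have h1 : Tendsto (fun n => ∫ t, f t ∂(singularLaw (M n))) atTop (𝓝 0) := by
    refine tendsto_const_nhds.congr' ?_
    filter_upwards [eventually_ge_atTop 1] with n hn
    rw [integral_singularLaw, Finset.sum_eq_zero, mul_zero]
    intro k _
    rw [hf, max_eq_left (by linarith [hM n hn k]), min_eq_right zero_le_one]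
  have h2 := tendsto_nhds_unique (hμ f) h1
  have h3 : 0 ≤ᵐ[μ] f := Eventually.of_forall fun t => le_min zero_le_one (le_max_left _ _)
  rw [integral_eq_zero_iff_of_nonneg_ae h3 (f.integrable μ)] at h2
  filter_upwards [h2] with t ht
  by_contra! hlt
  rw [hf] at ht
  have : 0 < min 1 (max 0 (t ^ 2 - R)) := lt_min one_pos (lt_max_of_lt_right (by linarith))
  exact this.ne' ht

theorem tendsto_logPotential (hR : 0 < R)
    (hM : ∀ n, 1 ≤ n → ∀ k : Fin n, singVal (M n) k ^ 2 ≤ R)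
    (hμ : ConvergesWeakly (fun n => singularLaw (M n)) μ) {w : ℝ} (hw : w ∈ Set.Ioo 0 R⁻¹) :
    Tendsto (fun n : ℕ => -(1 / 2) * (1 / (n : ℝ) * ∑ k, Real.log (1 - singVal (M n) k ^ 2 * w)))
      atTop (𝓝 (logPotential μ w)) := by
  have hc : 0 < 1 - R * w := by
    have := mul_lt_mul_of_pos_left hw.2 hR
    rw [mul_inv_cancel₀ hR.ne'] at this
    linarith
  have hw0 := hw.1
  have hmax : ∀ t : ℝ, t ^ 2 ≤ R → max (1 - R * w) (1 - t ^ 2 * w) = 1 - t ^ 2 * w := fun t ht =>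
    max_eq_right (by gcongr)
  have hpos : ∀ t : ℝ, 0 < max (1 - R * w) (1 - t ^ 2 * w) := fun t => lt_max_of_lt_left hc
  -- The logarithm is truncated below at `log (1 - R w)` to be an admissible test function; nothing
  -- changes where `t² ≤ R`.
  let f : ℝ →ᵇ ℝ := BoundedContinuousFunction.ofNormedAddCommGroup
    (fun t => Real.log (max (1 - R * w) (1 - t ^ 2 * w)))
    (Continuous.log (by fun_prop) fun t => (hpos t).ne') (-Real.log (1 - R * w)) fun t => by
      have h1 : max (1 - R * w) (1 - t ^ 2 * w) ≤ 1 := by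
        refine max_le ?_ ?_
        · have := mul_pos hR hw0; linarith
        · have := mul_nonneg (sq_nonneg t) hw0.le; linarith
      rw [Real.norm_of_nonpos (Real.log_nonpos (hpos t).le h1)]
      exact neg_le_neg (Real.log_le_log hc (le_max_left _ _))
  have hf : ∀ t, t ^ 2 ≤ R → f t = Real.log (1 - t ^ 2 * w) := fun t ht =>
    congrArg Real.log (hmax t ht)
  have h1 := (hμ f).const_mul (-(1 / 2))
  have h2 : ∫ t, f t ∂μ = ∫ t, Real.log (1 - t ^ 2 * w) ∂μ :=
    integral_congr_ae ((ae_sq_le_of_convergesWeakly hM hμ).mono hf)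
  rw [h2] at h1
  refine h1.congr' ?_
  filter_upwards [eventually_ge_atTop 1] with n hn
  rw [integral_singularLaw]
  congr 2
  exact Finset.sum_congr rfl fun k _ => hf _ (hM n hn k)

theorem tendsto_sphericalIntegral (hm : ∀ n, 1 ≤ n → n ≤ m n)
    {lam : ℝ} (h0 : 0 ≤ lam) (h1 : lam ≤ 1)
    (hlam : Tendsto (fun n : ℕ => (n : ℝ) / (m n : ℝ)) atTop (𝓝 lam)) (hR : 0 < R)
    (hM : ∀ n, 1 ≤ n → ∀ k : Fin n, singVal (M n) k ^ 2 ≤ R)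
    (hμ : ConvergesWeakly (fun n => singularLaw (M n)) μ)
    {E : ∀ n : ℕ, Matrix (Fin (m n)) (Fin n) 𝕜} (hE : ∀ n, 1 ≤ n → IsElementaryMatrix (E n))
    {θ : ℝ} (hθ : (θ / betaIndex 𝕜) ^ 2 < R⁻¹) :
    Tendsto (fun n => sphericalIntegral (E n) (M n) θ) atTop
      (𝓝 (rectLimit (betaIndex 𝕜) lam μ θ)) := by
  have hβ := betaIndex_pos 𝕜
  rcases eq_or_ne θ 0 with rfl | hθ0
  · simp [sphericalIntegral_zero, rectLimit]
  have hae := ae_sq_le_of_convergesWeakly hM hμ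
  obtain ⟨w, hw0, hw, hH⟩ := exists_rectH_eq h0 hR hae (show 0 < (θ / betaIndex 𝕜) ^ 2 by positivity)
    hθ
  have hx₀ := momentGen_nonneg (mem_rectDomain hR hae hw0.le hw)
  have hex : ∀ n : ℕ, ∃ (h : ℕ → ℝ) (F : ℝ → ℝ), 1 ≤ n → (∀ k, 0 ≤ h k) ∧ (∀ θ, 0 < F θ) ∧
      (∀ θ, sphericalIntegral (E n) (M n) θ = 1 / (n : ℝ) * Real.log (F θ)) ∧
      (∀ w ∈ Set.Ioo 0 R⁻¹, HasSum (fun k => h k * w ^ k) (Real.exp (betaIndex 𝕜 * n *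
        (-(1 / 2) * (1 / (n : ℝ) * ∑ k, Real.log (1 - singVal (M n) k ^ 2 * w)))))) ∧
      ∀ θ, HasSum (fun k => h k * ∏ i ∈ Finset.range k, ((θ / betaIndex 𝕜) ^ 2 /
        rectT ((n : ℝ) / m n) (2 / (betaIndex 𝕜 * n) * i))) (F θ) := by
    intro n
    by_cases hn : 1 ≤ n
    · obtain ⟨h, F, hF⟩ := exists_coeff_sphericalIntegral (hm n hn) (hE n hn) hR (hM n hn)
      exact ⟨h, F, fun _ => hF⟩
    · exact ⟨0, 0, fun h => absurd h hn⟩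
  choose h F hF using hex
  have hlap := tendsto_log_of_laplace (N := fun n : ℕ => betaIndex 𝕜 * n)
    (tendsto_natCast_atTop_atTop.const_mul_atTop hβ)
    (Eventually.of_forall fun n => by positivity) hlam (h := h) (κ := R⁻¹)
    ((eventually_ge_atTop 1).mono fun n hn => (hF n hn).1)
    (Λ := fun n w => -(1 / 2) * (1 / (n : ℝ) * ∑ k, Real.log (1 - singVal (M n) k ^ 2 * w)))
    (Λ' := logPotential μ)
    ((eventually_ge_atTop 1).mono fun n hn => (hF n hn).2.2.2.1)
    (fun w hw => tendsto_logPotential hR hM hμ hw) ⟨hw0, hw⟩ hx₀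
    (hasDerivAt_logPotential_momentGen hR hae hw0 hw) (F := fun n => F n θ)
    ((eventually_ge_atTop 1).mono fun n hn => by
      have := (hF n hn).2.2.2.2 θ
      -- Since `(θ / β)² = w T(M(w))`, the series has exactly the form required by Laplace's method
      -- at `w₀ = w`, `x₀ = M(w)`.
      rwa [← hH] at this)
  have hval := (rectRTransform_integral h0 h1 hR hae hw0 hw hH).2
  rw [rectEntropy_eq h0 hx₀] at hval
  rw [← hval] at hlap
  -- Laplace's method normalizes by `β n` and the spherical integral by `n`, whence the factor `β`.
  refine (hlap.const_mul (betaIndex 𝕜)).congr' ?_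
  filter_upwards [eventually_ge_atTop 1] with n hn
  have : (0 : ℝ) < n := by exact_mod_cast hn
  rw [(hF n hn).2.2.1]
  field_simp

end SphericalIntegral

theorem mainTheorem3 {𝕜 : Type*} [RCLike 𝕜]
    (m : ℕ → ℕ) (hm : ∀ n, 1 ≤ n → n ≤ m n)
    (lam : ℝ) (hlam : Tendsto (fun n : ℕ => (n : ℝ) / (m n : ℝ)) atTop (𝓝 lam))
    (hflat : lam = 0 → ∃ α : ℝ, α < 2 ∧ ∀ᶠ n : ℕ in atTop, (m n : ℝ) ≤ (n : ℝ) ^ α)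
    (M : ∀ n : ℕ, Matrix (Fin n) (Fin (m n)) 𝕜)
    (K : ℝ) (hK : ∀ n, 1 ≤ n → ∀ k : Fin n, singVal (M n) k < K)
    (μ : Measure ℝ) [IsProbabilityMeasure μ]
    (hμ : ConvergesWeakly (fun n => singularLaw (M n)) μ)
    (E : ∀ n : ℕ, Matrix (Fin (m n)) (Fin n) 𝕜)
    (hE : ∀ n, 1 ≤ n → IsElementaryMatrix (E n)) :
    (lam = 1 →
      (∀ S : Set ℝ, S ⊆ Set.Ioo (-(betaIndex 𝕜 / K)) (betaIndex 𝕜 / K) → IsCompact S →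
        TendstoUniformlyOn (fun (n : ℕ) (θ : ℝ) => sphericalIntegral (E n) (M n) θ)
          (rectLimit (betaIndex 𝕜) 1 μ) atTop S) ∧
      ∀ θ ∈ Set.Ioo (-(betaIndex 𝕜 / K)) (betaIndex 𝕜 / K),
        IntervalIntegrable (rTransform (symmetrization μ)) volume 0 (θ / betaIndex 𝕜) ∧
        rectLimit (betaIndex 𝕜) 1 μ θ =
          betaIndex 𝕜 * ∫ t in (0 : ℝ)..(θ / betaIndex 𝕜), rTransform (symmetrization μ) t) ∧
    (lam = 0 →
      (∀ S : Set ℝ, S ⊆ Set.Ioo (-(betaIndex 𝕜 / K)) (betaIndex 𝕜 / K) → IsCompact S →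
        TendstoUniformlyOn (fun (n : ℕ) (θ : ℝ) => sphericalIntegral (E n) (M n) θ)
          (rectLimit (betaIndex 𝕜) 0 μ) atTop S) ∧
      ∀ θ ∈ Set.Ioo (-(betaIndex 𝕜 / K)) (betaIndex 𝕜 / K),
        IntervalIntegrable (fun t => t * rTransform (squareLaw μ) (t ^ 2)) volume
          0 (θ / betaIndex 𝕜) ∧
        rectLimit (betaIndex 𝕜) 0 μ θ =
          betaIndex 𝕜 *
            ∫ t in (0 : ℝ)..(θ / betaIndex 𝕜), t * rTransform (squareLaw μ) (t ^ 2)) := by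
  have hβ := betaIndex_pos 𝕜
  -- The case `n = 1` supplies a nonnegative singular value below `K`.
  have hK0 : 0 < K := (singVal_nonneg (M 1) 0).trans_lt (hK 1 le_rfl 0)
  have hR : 0 < K ^ 2 := by positivity
  have hM : ∀ n, 1 ≤ n → ∀ k : Fin n, singVal (M n) k ^ 2 ≤ K ^ 2 := fun n hn k =>
    pow_le_pow_left₀ (singVal_nonneg _ _) (hK n hn k).le 2
  have hae := ae_sq_le_of_convergesWeakly hM hμ
  have hθ : ∀ θ ∈ Set.Ioo (-(betaIndex 𝕜 / K)) (betaIndex 𝕜 / K),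
      (θ / betaIndex 𝕜) ^ 2 < (K ^ 2)⁻¹ := by
    intro θ hθ
    have h1 : |θ| < betaIndex 𝕜 / K := abs_lt.2 hθ
    have h2 : |θ / betaIndex 𝕜| < K⁻¹ := by
      rw [abs_div, abs_of_pos hβ, div_lt_iff₀ hβ]
      rwa [div_eq_inv_mul] at h1
    rw [← inv_pow, ← sq_abs]
    exact pow_lt_pow_left₀ h2 (abs_nonneg _) two_ne_zero
  have huniform : ∀ l, 0 ≤ l → l ≤ 1 → lam = l → ∀ S : Set ℝ,
      S ⊆ Set.Ioo (-(betaIndex 𝕜 / K)) (betaIndex 𝕜 / K) → IsCompact S →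
        TendstoUniformlyOn (fun (n : ℕ) (θ : ℝ) => sphericalIntegral (E n) (M n) θ)
          (rectLimit (betaIndex 𝕜) l μ) atTop S := by
    rintro l h0 h1 rfl S hS hSc
    refine (tendstoLocallyUniformlyOn_iff_forall_isCompact isOpen_Ioo).1
      (tendstoLocallyUniformlyOn_of_monotone_abs ?_
        (fun θ hθ' => tendsto_sphericalIntegral hm h0 h1 hlam hR hM hμ hE (hθ θ hθ'))
        (continuousOn_rectLimit hβ h0 h1 hR hae hθ)) S hS hSc
    filter_upwards [eventually_ge_atTop 1] with n hn x y hxy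
    exact sphericalIntegral_mono (hm n hn) (hE n hn) hxy
  refine ⟨fun h => ⟨huniform 1 zero_le_one le_rfl h, fun θ hθ' => ?_⟩,
    fun h => ⟨huniform 0 le_rfl zero_le_one h, fun θ hθ' => ?_⟩⟩
  · obtain ⟨h1, h2⟩ := integral_congr_of_sq_lt (hθ θ hθ')
      (fun t ht => rectRTransform_one_div_eq hR hae ht)
      (intervalIntegrable_rectRTransform zero_le_one le_rfl hR hae (hθ θ hθ'))
    exact ⟨h1, by rw [rectLimit, h2]⟩
  · obtain ⟨h1, h2⟩ := integral_congr_of_sq_lt (hθ θ hθ')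
      (fun t ht => rectRTransform_zero_div_eq hR hae ht)
      (intervalIntegrable_rectRTransform le_rfl zero_le_one hR hae (hθ θ hθ'))
    exact ⟨h1, by rw [rectLimit, h2]⟩
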